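/- Let $K$ be a field, $p\in K$, $p\neq 0$, and put $q=p^{-3}$. The fourth $q$-Painlevé equation $q\mathrm{P}_{\mathrm{IV}}$ with parameters $a_0,a_1,a_2$, $a_0a_1a_2=q$, is the system (indices modulo $3$) $$\overline{f_i}=a_ia_{i+1}f_{i+1}\,\frac{1+a_{i+2}f_{i+2}+a_{i+2}a_if_{i+2}f_i}{1+a_if_i+a_ia_{i+1}f_if_{i+1}},\qquad f_0f_1f_2=qc^2,\qquad \overline{c}=qc .$$ With $x=c^{2/3}$ the time evolution of a rational function $g(x)\in K(x)$ is $\overline{g}(x)=g(xp^{-2})$, and $f_0f_1f_2=qx^3$. The Bäcklund transformations $s_0,s_1,s_2,\pi$ are the automorphisms of the field of rational functions in $a_0,a_1,a_2,f_0,f_1,f_2$ given by $s_i(a_i)=a_i^{-1}$, $s_i(a_j)=a_ja_i$ for $j\ne i$, $s_i(f_i)=f_i$, $$s_i(f_{i+1})=f_{i+1}\frac{a_i+f_i}{1+a_if_i},\qquad s_i(f_{i+2})=f_{i+2}\frac{1+a_if_i}{a_i+f_i},\qquad \pi(a_j)=a_{j+1},\quad \pi(f_j)=f_{j+1},$$ and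 $T_1=\pi s_2s_1$, $T_2=s_1\pi s_2$. **Theorem.** There is exactly one family of polynomials $Q_{m,n}(x)\in K[x]$, $m,n\in\mathbb Z$, with $Q_{0,0}=Q_{1,0}=Q_{1,1}=1$ that satisfies, for all $m,n\in\mathbb Z$, \begin{align*} Q_{m-1,n}(x)Q_{m+1,n+1}(xp^{-2})&=Q_{m,n}(x)Q_{m,n+1}(xp^{-2})+xp^{-2m-2n}Q_{m,n+1}(x)Q_{m,n}(xp^{-2}),\\ Q_{m+1,n}(x)Q_{m,n+1}(xp^{-2})&=Q_{m+1,n+1}(x)Q_{m,n}(xp^{-2})+xp^{4m-2n-2}Q_{m,n}(x)Q_{m+1,n+1}(xp^{-2}),\\ Q_{m+1,n+1}(x)Q_{m,n-1}(xp^{-2})&=Q_{m,n}(x)Q_{m+1,n}(xp^{-2})+xp^{4n-2m-2}Q_{m+1,n}(x)Q_{m,n}(xp^{-2}), \end{align*} and every $Q_{m,n}$ is monic (these are the $q$-Okamoto polynomials). For all $m,n\in\mathbb Z$, the rational functions $T_1^mT_2^n(a_i)$, $T_1^mT_2^n(f_i)$ can be evaluated at the seed $a_0=a_1=a_2=p^{-1}$,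 $f_0=f_1=f_2=xp^{-1}$ (applying the generators one after another, no denominator vanishes), and their values there are $$T_1^mT_2^n(a_0,a_1,a_2)=(p^{-3m-1},\,p^{3m-3n-1},\,p^{3n-1}),$$ \begin{align*} T_1^mT_2^n(f_0)&=xp^{m-2n-1}\frac{Q_{m+1,n}(xp^{-2})\,Q_{m+1,n+1}(x)}{Q_{m+1,n}(x)\,Q_{m+1,n+1}(xp^{-2})},\\ T_1^mT_2^n(f_1)&=xp^{m+n-1}\frac{Q_{m+1,n+1}(xp^{-2})\,Q_{m,n}(x)}{Q_{m+1,n+1}(x)\,Q_{m,n}(xp^{-2})},\\ T_1^mT_2^n(f_2)&=xp^{n-2m-1}\frac{Q_{m,n}(xp^{-2})\,Q_{m+1,n}(x)}{Q_{m,n}(x)\,Q_{m+1,n}(xp^{-2})}. \end{align*} These three functions of $x$ are a solution of $q\mathrm{P}_{\mathrm{IV}}$ with the parameters $(p^{-3m-1},p^{3m-3n-1},p^{3n-1})$. -/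

import Mathlib

open Polynomial

noncomputable section

namespace QP4

/-! ### Bäcklund transformations of the fourth `q`-Painlevé equation

The indices `0, 1, 2` are elements of `Fin 3`, whose addition is modulo `3`. -/

/-- A point: values of the parameters `a₀, a₁, a₂` and of the dependent variables
`f₀, f₁, f₂` in a field `L`. -/
structure Point (L : Type*) where
  a : Fin 3 → L
  f : Fin 3 → L

/-- The generalized Cartan matrix of type `A₂⁽¹⁾`. -/
def cartan : Matrix (Fin 3) (Fin 3) ℤ :=
  !![2, -1, -1; -1, 2, -1; -1, -1, 2]

/-- The orientation matrix of the Dynkin diagram of type `A₂⁽¹⁾`. -/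
def orient : Matrix (Fin 3) (Fin 3) ℤ :=
  !![0, 1, -1; -1, 0, 1; 1, -1, 0]

/-- The generators `s₀, s₁, s₂, π` of the extended affine Weyl group, and `π⁻¹`
(each `sᵢ` is its own inverse). -/
inductive Gen
  | s (i : Fin 3)
  | rot
  | rotInv

namespace Gen

/-- The values `w(aⱼ)`, `w(fⱼ)` at a point, for a generator `w`:
`sᵢ(aⱼ) = aⱼ aᵢ ^ (-Aᵢⱼ)`, `sᵢ(fⱼ) = fⱼ ((aᵢ + fᵢ) / (1 + aᵢ fᵢ)) ^ Uᵢⱼ`,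
`π(aⱼ) = aⱼ₊₁`, `π(fⱼ) = fⱼ₊₁`. -/
def act {L : Type*} [Field L] : Gen → Point L → Point L
  | s i, P =>
      { a := fun j => P.a j * P.a i ^ (-cartan i j)
        f := fun j => P.f j * ((P.a i + P.f i) / (1 + P.a i * P.f i)) ^ orient i j }
  | rot, P => { a := fun j => P.a (j + 1), f := fun j => P.f (j + 1) }
  | rotInv, P => { a := fun j => P.a (j - 1), f := fun j => P.f (j - 1) }

/-- Every denominator in the formulas for the generator is nonzero at the point. -/
def Regular {L : Type*} [Field L] : Gen → Point L → Prop
  | s i, P => P.a i ≠ 0 ∧ P.a i + P.f i ≠ 0 ∧ 1 + P.a i * P.f i ≠ 0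
  | rot, _ => True
  | rotInv, _ => True

/-- The inverse generator. -/
def inv : Gen → Gen
  | s i => s i
  | rot => rotInv
  | rotInv => rot

end Gen

/-- `Sends [g₁, …, g_k] P P'` says that the transformation `w = g₁ g₂ ⋯ g_k`, a product of
automorphisms of the field of rational functions in `a₀, a₁, a₂, f₀, f₁, f₂`, can be evaluated
at the point `P`, and that `P'` consists of the values at `P` of the functions
`w(a₀), w(a₁), w(a₂), w(f₀), w(f₁), w(f₂)`. Since `(g₁ g₂)(φ) = g₁(g₂(φ))`, the value of
`(g₁ g₂)(φ)` at `P` is the value of `g₂(φ)` at the point made of the values of `g₁(aⱼ)`, `g₁(fⱼ)`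
at `P`; so the letters of the word are used from left to right.  No denominator may vanish. -/
def Sends {L : Type*} [Field L] : List Gen → Point L → Point L → Prop
  | [], P, P' => P' = P
  | g :: w, P, P' => g.Regular P ∧ Sends w (g.act P) P'

/-- The word for `w⁻¹`. -/
def wordInv (w : List Gen) : List Gen := (w.map Gen.inv).reverse

/-- The word for the integer power `wᵏ`. -/
def wordZPow (w : List Gen) : ℤ → List Gen
  | Int.ofNat k => (List.replicate k w).flatten
  | Int.negSucc k => (List.replicate (k + 1) (wordInv w)).flatten

/-- The Schlesinger transformation `T₁ = π s₂ s₁`. -/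
def T₁ : List Gen := [Gen.rot, Gen.s 2, Gen.s 1]

/-- The Schlesinger transformation `T₂ = s₁ π s₂`. -/
def T₂ : List Gen := [Gen.s 1, Gen.rot, Gen.s 2]

/-! ### Rational solutions -/

variable {K : Type*} [Field K]

/-- `R(x) ↦ R(x p⁻²)` on polynomials. -/
def polyShift (p : K) (R : K[X]) : K[X] := R.comp (C (p ^ (-2 : ℤ)) * X)

/-- The time evolution `g(x) ↦ g(x p⁻²)` on rational functions in `x`.  With `x = c ^ (2/3)` and
`q = p⁻³` this is `c ↦ q c`.  (For `p ≠ 0` the substitution is defined on all of `K(x)`.) -/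
def timeShift (p : K) (g : RatFunc K) : RatFunc K :=
  g.eval (algebraMap K (RatFunc K)) (RatFunc.C (p ^ (-2 : ℤ)) * RatFunc.X)

/-- The rational functions `f₀, f₁, f₂` of `x` solve the fourth `q`-Painlevé equation with constant
parameters `a₀, a₁, a₂`, where `a₀ a₁ a₂ = q = p⁻³`, `f₀ f₁ f₂ = q c² = q x³`, and
`f̄ᵢ = aᵢ aᵢ₊₁ fᵢ₊₁ (1 + aᵢ₊₂ fᵢ₊₂ + aᵢ₊₂ aᵢ fᵢ₊₂ fᵢ) / (1 + aᵢ fᵢ + aᵢ aᵢ₊₁ fᵢ fᵢ₊₁)`. -/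
def IsRationalSolution (p : K) (a : Fin 3 → K) (f : Fin 3 → RatFunc K) : Prop :=
  let b : Fin 3 → RatFunc K := fun i => RatFunc.C (a i)
  a 0 * a 1 * a 2 = p ^ (-3 : ℤ) ∧
  f 0 * f 1 * f 2 = RatFunc.C (p ^ (-3 : ℤ)) * RatFunc.X ^ 3 ∧
  ∀ i : Fin 3,
    1 + b i * f i + b i * b (i + 1) * f i * f (i + 1) ≠ 0 ∧
    timeShift p (f i) =
      b i * b (i + 1) * f (i + 1) *
        ((1 + b (i + 2) * f (i + 2) + b (i + 2) * b i * f (i + 2) * f i) /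
          (1 + b i * f i + b i * b (i + 1) * f i * f (i + 1)))

/-- The seed: `a₀ = a₁ = a₂ = p⁻¹`, `f₀ = f₁ = f₂ = x p⁻¹`. -/
def seed (p : K) : Point (RatFunc K) where
  a := fun _ => RatFunc.C (p ^ (-1 : ℤ))
  f := fun _ => RatFunc.X * RatFunc.C (p ^ (-1 : ℤ))

/-! ### The `q`-Okamoto polynomials -/

/-- The three families of recurrence relations and the initial conditions for the `q`-Okamoto
polynomials `Q_{m,n}(x)`, `m, n ∈ ℤ`. -/
structure IsQOkamoto (p : K) (Q : ℤ → ℤ → K[X]) : Prop where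
  rec₁ : ∀ m n : ℤ,
    Q (m - 1) n * polyShift p (Q (m + 1) (n + 1)) =
      Q m n * polyShift p (Q m (n + 1)) +
        X * C (p ^ (-2 * m - 2 * n)) * Q m (n + 1) * polyShift p (Q m n)
  rec₂ : ∀ m n : ℤ,
    Q (m + 1) n * polyShift p (Q m (n + 1)) =
      Q (m + 1) (n + 1) * polyShift p (Q m n) +
        X * C (p ^ (4 * m - 2 * n - 2)) * Q m n * polyShift p (Q (m + 1) (n + 1))
  rec₃ : ∀ m n : ℤ,
    Q (m + 1) (n + 1) * polyShift p (Q m (n - 1)) =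
      Q m n * polyShift p (Q (m + 1) n) +
        X * C (p ^ (4 * n - 2 * m - 2)) * Q (m + 1) n * polyShift p (Q m n)
  init₀₀ : Q 0 0 = 1
  init₁₀ : Q 1 0 = 1
  init₁₁ : Q 1 1 = 1

/-- The ratio `R(x p⁻²) S(x) / (R(x) S(x p⁻²))`. -/
def shiftRatio (p : K) (R S : K[X]) : RatFunc K :=
  (algebraMap K[X] (RatFunc K) (polyShift p R) * algebraMap K[X] (RatFunc K) S) /
    (algebraMap K[X] (RatFunc K) R * algebraMap K[X] (RatFunc K) (polyShift p S))

/-- The parameters `(p^(-3m-1), p^(3m-3n-1), p^(3n-1))`. -/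
def okamotoParam (p : K) (m n : ℤ) : Fin 3 → K :=
  ![p ^ (-3 * m - 1), p ^ (3 * m - 3 * n - 1), p ^ (3 * n - 1)]

/-- The rational functions built from the family `Q`. -/
def okamotoSolution (p : K) (Q : ℤ → ℤ → K[X]) (m n : ℤ) : Fin 3 → RatFunc K :=
  ![RatFunc.X * RatFunc.C (p ^ (m - 2 * n - 1)) *
      shiftRatio p (Q (m + 1) n) (Q (m + 1) (n + 1)),
    RatFunc.X * RatFunc.C (p ^ (m + n - 1)) *
      shiftRatio p (Q (m + 1) (n + 1)) (Q m n),
    RatFunc.X * RatFunc.C (p ^ (n - 2 * m - 1)) *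
      shiftRatio p (Q m n) (Q (m + 1) n)]

end QP4

end

/-! The polynomials sit at the points of a triangular lattice, and the three functions `f₀, f₁, f₂`
depend only on the polynomials `A, B, C` at the vertices of one triangle (`triPoint`). A
transformation `sᵢ` replaces one vertex by its mirror image across the opposite side. The image `N`
of `A` is governed by two bilinear relations (`Refl`), which factor `1 + a₀ f₀` and `a₀ + f₀`;
dividing them gives the action of `s₀` (`triPoint_s_zero`). The recurrences for `Q` are instances of
the same relations.

The difficulty is to see that repeated reflection never leaves the polynomials. `Good` collects what
is propagated: monic polynomials with constant term 1, coprimality, divisibility, and the cyclic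
identities `TriId` involving second time shifts. Divisibility produces `N` from the right relation,
`TriId` then forces the left one (`Refl.of_right`), and coprimality allows the common factor `A * sh
t A` to be cancelled when divisibility is transported to the new triangle (`Good.reflect`). `TriId`
also factors the denominators of the Painlevé equation, so it yields the solutions
(`timeShift_triPoint`).

The coprimality argument needs distinct powers of `t = p⁻²`. Hence `p` is first taken to be an
indeterminate, over `ℤ[p, p⁻¹]`, and afterwards specialised to the given element of `K`. Constant
term 1 and monicity survive the specialisation, so no denominator vanishes even if `p` is a root of
unity.

Reflections are involutive permutations of the good triangles and satisfy the braid relation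
(`braid`). Therefore `T₁` and `T₂` commute (`commute_T`), and the triangle reached depends only on
`(m, n)`. Uniqueness follows by solving the recurrences across the lattice, starting from the three
initial values. -/

open Polynomial

noncomputable section

namespace QP4

/-! ### Reflection relations and the second-shift identities -/

section Triangles

variable {R : Type*} [CommRing R]

/-- The substitution `x ↦ t x` on polynomials. -/
def sh (t : Rˣ) : R[X] →+* R[X] := compRingHom (C (t : R) * X)

/-- The constant polynomial `t ^ k`. -/
def mon (t : Rˣ) (k : ℤ) : R[X] := C ((t ^ k : Rˣ) : R)

theorem mon_add (t : Rˣ) (j k : ℤ) : mon t (j + k) = mon t j * mon t k := by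
  simp [mon, zpow_add]

@[simp] theorem mon_zero (t : Rˣ) : mon t 0 = 1 := by simp [mon]

theorem mon_ne_zero [Nontrivial R] (t : Rˣ) (k : ℤ) : mon t k ≠ 0 := by simp [mon]

@[simp] theorem sh_X (t : Rˣ) : sh t X = mon t 1 * X := by simp [sh, mon]

@[simp] theorem sh_mon (t : Rˣ) (k : ℤ) : sh t (mon t k) = mon t k := by simp [sh, mon]

@[simp] theorem coeff_zero_sh (t : Rˣ) (P : R[X]) : (sh t P).coeff 0 = P.coeff 0 := by
  simp [sh, coeff_zero_eq_eval_zero, eval_comp]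

theorem coeff_sh (t : Rˣ) (P : R[X]) (k : ℕ) :
    (sh t P).coeff k = P.coeff k * ((t : R) ^ k) := by
  simp [sh, comp_C_mul_X_coeff]

theorem sh_injective (t : Rˣ) : Function.Injective (sh t) := by
  intro P Q h
  ext k
  have := congrArg (fun S => coeff S k) h
  simp only [coeff_sh] at this
  exact ((t ^ k).isUnit.mul_left_inj).1 (by simpa using this)

theorem natDegree_sh (t : Rˣ) (P : R[X]) : (sh t P).natDegree = P.natDegree := by
  apply le_antisymm
  · refine natDegree_le_iff_coeff_eq_zero.2 fun k hk => ?_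
    rw [coeff_sh, coeff_eq_zero_of_natDegree_lt hk, zero_mul]
  · refine natDegree_le_iff_coeff_eq_zero.2 fun k hk => ?_
    have := coeff_eq_zero_of_natDegree_lt hk
    rw [coeff_sh] at this
    exact ((t ^ k).isUnit.mul_left_eq_zero).1 (by simpa using this)

theorem leadingCoeff_sh (t : Rˣ) (P : R[X]) :
    (sh t P).leadingCoeff = P.leadingCoeff * (t : R) ^ P.natDegree := by
  rw [leadingCoeff, natDegree_sh, coeff_sh, leadingCoeff]

theorem map_sh {S : Type*} [CommRing S] (φ : R →+* S) (t : Rˣ) (P : R[X]) :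
    (sh t P).map φ = sh (Units.map φ.toMonoidHom t) (P.map φ) := by
  simp [sh, Polynomial.map_comp]

theorem map_mon {S : Type*} [CommRing S] (φ : R →+* S) (t : Rˣ) (k : ℤ) :
    (mon t k).map φ = mon (Units.map φ.toMonoidHom t) k := by
  simp only [mon, map_C, ← map_zpow]
  rfl

theorem ne_zero_of_coeff_zero [Nontrivial R] {P : R[X]} (h : P.coeff 0 = 1) : P ≠ 0 := by
  rintro rfl
  simp at h

/-- `N` is the reflection of the vertex `A` of the triangle `A, B, C` across the side `B, C`;
`a, b, c` are the degrees of `A, B, C`. -/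
structure Refl (t : Rˣ) (A N B C : R[X]) (a b c : ℤ) : Prop where
  left : A * sh t N = B * sh t C + mon t (1 + c - a) * X * (sh t B * C)
  right : sh t A * N = B * sh t C + mon t (a - b) * X * (sh t B * C)

theorem Refl.symm {t : Rˣ} {A N B C : R[X]} {a b c : ℤ} (h : Refl t A N B C a b c) :
    Refl t N A B C (b + c + 1 - a) b c where
  left := by
    rw [mul_comm, h.right, show 1 + c - (b + c + 1 - a) = a - b by ring]
  right := by
    rw [mul_comm, h.left, show b + c + 1 - a - b = 1 + c - a by ring]

theorem Refl.unique [IsDomain R] {t : Rˣ} {A N N' B C : R[X]} {a b c : ℤ} (hA : A.coeff 0 = 1)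
    (h : Refl t A N B C a b c) (h' : Refl t A N' B C a b c) : N = N' :=
  mul_left_cancel₀ (ne_zero_of_coeff_zero (by simpa using hA)) (h.right.trans h'.right.symm)

theorem Refl.map {S : Type*} [CommRing S] (φ : R →+* S) {t : Rˣ} {A N B C : R[X]} {a b c : ℤ}
    (h : Refl t A N B C a b c) :
    Refl (Units.map φ.toMonoidHom t) (A.map φ) (N.map φ) (B.map φ) (C.map φ) a b c where
  left := by
    simpa only [Polynomial.map_mul, Polynomial.map_add, map_sh, map_mon, map_X]
      using congrArg (Polynomial.map φ) h.left
  right := by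
    simpa only [Polynomial.map_mul, Polynomial.map_add, map_sh, map_mon, map_X]
      using congrArg (Polynomial.map φ) h.right

/-- The polynomial `1 + t x + t² x²`. -/
def lam (t : Rˣ) : R[X] := 1 + mon t 1 * X + mon t 2 * X ^ 2

/-- The relation between a triangle and its second time shift. -/
def TriId (t : Rˣ) (A B C : R[X]) (a b c : ℤ) : Prop :=
  lam t * (A * B * sh t (sh t C)) =
    sh t A * B * sh t C + mon t (1 + c - a) * X * (sh t A * sh t B * C) +
      mon t (2 + c - b) * X ^ 2 * (A * sh t B * sh t C)

theorem TriId.map {S : Type*} [CommRing S] (φ : R →+* S) {t : Rˣ} {A B C : R[X]} {a b c : ℤ}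
    (h : TriId t A B C a b c) :
    TriId (Units.map φ.toMonoidHom t) (A.map φ) (B.map φ) (C.map φ) a b c := by
  simpa only [TriId, lam, Polynomial.map_mul, Polynomial.map_add, Polynomial.map_pow, map_sh,
    map_mon, map_X, Polynomial.map_one] using congrArg (Polynomial.map φ) h

theorem lam_ne_zero [Nontrivial R] (t : Rˣ) : lam t ≠ 0 :=
  ne_zero_of_coeff_zero (by simp [lam, mon])

variable {t : Rˣ} {A N B C : R[X]} {a b c : ℤ}

/-- After multiplication by `A * sh t A`, the new vertex enters only through `A * sh t N` and `sh t
A * N`, and the reflection relations reduce the claim to the old identity. The next lemma works in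
the same way for another position of the vertex. -/
theorem TriId.reflect_fst [IsDomain R] (hA : A.coeff 0 = 1) (h : Refl t A N B C a b c)
    (h₂ : TriId t A B C a b c) : TriId t N B C (b + c + 1 - a) b c := by
  have hA0 := ne_zero_of_coeff_zero hA
  have hA1 : sh t A ≠ 0 := ne_zero_of_coeff_zero (by simpa using hA)
  refine mul_left_cancel₀ (mul_ne_zero hA0 hA1) ?_
  obtain ⟨h, h'⟩ := h
  rw [TriId] at h₂
  rw [show 1 + c - (b + c + 1 - a) = a - b by ring]
  linear_combination (lam t * A * B * sh t (sh t C) -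
      mon t (2 + c - b) * X ^ 2 * A * sh t B * sh t C) * h' +
    (B * sh t C + mon t (a - b) * X * (sh t B * C)) * h₂ -
    sh t A * (B * sh t C + mon t (a - b) * X * (sh t B * C)) * h

theorem TriId.reflect_snd [IsDomain R] (hA : A.coeff 0 = 1) (h : Refl t A N B C a b c)
    (h₁ : TriId t C A B c a b) : TriId t C N B c (b + c + 1 - a) b := by
  have hA0 := ne_zero_of_coeff_zero hA
  have hA1 : sh t A ≠ 0 := ne_zero_of_coeff_zero (by simpa using hA)
  refine mul_left_cancel₀ (mul_ne_zero hA0 hA1) ?_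
  obtain ⟨h, h'⟩ := h
  rw [TriId] at h₁
  have e₁ : mon t (2 + b - (b + c + 1 - a)) = mon t (1 + b - c) * mon t (a - b) := by
    rw [← mon_add]; congr 1; ring
  have e₂ : mon t (2 + b - a) = mon t (1 + b - c) * mon t (1 + c - a) := by
    rw [← mon_add]; congr 1; ring
  rw [e₂] at h₁
  rw [e₁]
  linear_combination (lam t * C * A * sh t (sh t B) - A * sh t C * sh t B) * h' +
    (B * sh t C + mon t (a - b) * X * (sh t B * C)) * h₁ -
    sh t A * (mon t (1 + b - c) * X * sh t C * B +
      mon t (1 + b - c) * mon t (a - b) * X ^ 2 * C * sh t B) * h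

/-- In this position the second shift of `N` occurs. It is removed by the time shift of the left
relation, which brings in second shifts of both `B` and `C`; hence two of the old identities are
needed. -/
theorem TriId.reflect_thd [IsDomain R] (hA : A.coeff 0 = 1) (h : Refl t A N B C a b c)
    (h₂ : TriId t A B C a b c) (h₁ : TriId t C A B c a b) :
    TriId t B C N b c (b + c + 1 - a) := by
  have hA0 := ne_zero_of_coeff_zero hA
  have hA1 : sh t A ≠ 0 := ne_zero_of_coeff_zero (by simpa using hA)
  refine mul_left_cancel₀ (mul_ne_zero hA0 hA1) ?_
  obtain ⟨h, h'⟩ := h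
  rw [TriId] at h₁ h₂
  have hs := congrArg (sh t) h
  simp only [map_add, map_mul, sh_mon, sh_X] at hs
  have e₁ : mon t (1 + (b + c + 1 - a) - b) = mon t 1 * mon t (1 + c - a) := by
    rw [← mon_add]; congr 1; ring
  have e₂ : mon t (2 + (b + c + 1 - a) - c) =
      mon t 1 * mon t (1 + c - a) * mon t (1 + b - c) := by
    rw [← mon_add, ← mon_add]; congr 1; ring
  have e₃ : mon t (2 + c - b) = mon t 1 * mon t (1 + c - a) * mon t (a - b) := by
    rw [← mon_add, ← mon_add]; congr 1; ring
  have e₄ : mon t (2 + b - a) = mon t (1 + b - c) * mon t (1 + c - a) := by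
    rw [← mon_add]; congr 1; ring
  rw [e₃] at h₂
  rw [e₄] at h₁
  rw [e₁, e₂]
  linear_combination lam t * A * B * C * hs + C * sh t B * h₂ +
    mon t (1 + c - a) * mon t 1 * X * B * sh t C * h₁ -
    (sh t A * sh t B * C + mon t 1 * mon t (1 + c - a) * mon t (1 + b - c) * X ^ 2 *
      (sh t A * B * sh t C)) * h - mon t 1 * mon t (1 + c - a) * X * A * sh t B * sh t C * h'

/-- A polynomial satisfying one of the two reflection relations satisfies the other. -/
theorem Refl.of_right [IsDomain R] (hA : A.coeff 0 = 1) (hB : B.coeff 0 = 1) (hC : C.coeff 0 = 1)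
    (h₂ : TriId t A B C a b c) (h₀ : TriId t B C A b c a) (h₁ : TriId t C A B c a b)
    (h' : sh t A * N = B * sh t C + mon t (a - b) * X * (sh t B * C)) :
    Refl t A N B C a b c := by
  refine ⟨?_, h'⟩
  have hA2 : sh t (sh t A) ≠ 0 := ne_zero_of_coeff_zero (by simpa using hA)
  refine mul_left_cancel₀ (mul_ne_zero (mul_ne_zero (lam_ne_zero t) hA2)
    (mul_ne_zero (ne_zero_of_coeff_zero hB) (ne_zero_of_coeff_zero hC))) ?_
  -- The shifted right relation expresses `sh t N` through second shifts of `A`, `B`, `C`. Each of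
  -- the three identities eliminates one of them, at the cost of the factor `lam t`.
  have hs := congrArg (sh t) h'
  simp only [map_add, map_mul, sh_mon, sh_X] at hs
  rw [TriId] at h₀ h₁ h₂
  have e₀ : mon t (1 + a - b) = mon t 1 * mon t (a - b) := by
    rw [← mon_add]; congr 1; ring
  have e₁ : mon t (2 + a - c) = mon t 1 * mon t (a - b) * mon t (1 + b - c) := by
    rw [← mon_add, ← mon_add]; congr 1; ring
  have e₃ : mon t (2 + c - b) = mon t 1 * mon t (1 + c - a) * mon t (a - b) := by
    rw [← mon_add, ← mon_add]; congr 1; ring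
  have e₄ : mon t (2 + b - a) = mon t (1 + b - c) * mon t (1 + c - a) := by
    rw [← mon_add]; congr 1; ring
  rw [e₃] at h₂
  rw [e₄] at h₁
  rw [e₀, e₁] at h₀
  linear_combination lam t * A * B * C * hs + C * sh t B * h₂ +
    mon t (a - b) * mon t 1 * X * B * sh t C * h₁ -
    (B * sh t C + mon t (1 + c - a) * X * (sh t B * C)) * h₀

end Triangles

/-! ### Coprimality and divisibility through the fraction field -/

section Coprime

variable {R : Type*} [CommRing R]

/-- Coprimality over the field of fractions of the coefficient ring. -/
def Cop (A B : R[X]) : Prop :=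
  IsCoprime (A.map (algebraMap R (FractionRing R))) (B.map (algebraMap R (FractionRing R)))

theorem Cop.symm {A B : R[X]} (h : Cop A B) : Cop B A := IsCoprime.symm h

theorem Cop.mul_right {A B C : R[X]} (h : Cop A B) (h' : Cop A C) : Cop A (B * C) := by
  rw [Cop, Polynomial.map_mul]
  exact IsCoprime.mul_right h h'

theorem Cop.of_mul_right {A B C : R[X]} (h : Cop A (B * C)) : Cop A C := by
  rw [Cop, Polynomial.map_mul] at h
  exact IsCoprime.of_mul_right_right h

theorem Cop.add_of_dvd {A U V : R[X]} (h : Cop A V) (hU : A ∣ U) : Cop A (U + V) := by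
  obtain ⟨D, rfl⟩ := hU
  rw [Cop, Polynomial.map_add, Polynomial.map_mul, add_comm]
  exact IsCoprime.add_mul_left_right h _

theorem Cop.sh {A B : R[X]} (h : Cop A B) (t : Rˣ) : Cop (sh t A) (sh t B) := by
  rw [Cop, map_sh, map_sh]
  exact IsCoprime.map h _

theorem cop_mon (t : Rˣ) (A : R[X]) (k : ℤ) : Cop A (mon t k) := by
  have : IsUnit (mon t k) := (t ^ k).isUnit.map C
  obtain ⟨u, hu⟩ := this.map (mapRingHom (algebraMap R (FractionRing R)))
  refine ⟨0, ((u⁻¹ : _ˣ) : (FractionRing R)[X]), ?_⟩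
  rw [← coe_mapRingHom, ← hu, zero_mul, zero_add, Units.inv_mul]

theorem cop_X {A : R[X]} (h : A.coeff 0 = 1) : Cop A X := by
  have : IsCoprime A X := ⟨1, -divX A, by
    have := divX_mul_X_add A
    rw [h] at this
    simp only [map_one] at this
    linear_combination -this⟩
  exact this.map (mapRingHom (algebraMap R (FractionRing R)))

theorem cop_one (A : R[X]) : Cop A 1 := by
  rw [Cop, Polynomial.map_one]
  exact isCoprime_one_right

variable [IsDomain R]

/-- A divisor whose leading coefficient is a unit, coprime to one factor, divides the other. -/
theorem Cop.dvd_of_dvd_mul_left {A B C : R[X]} (hA : IsUnit A.leadingCoeff) (h : Cop A B)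
    (hd : A ∣ B * C) : A ∣ C := by
  obtain ⟨u, hu⟩ := hA
  -- For a monic divisor, divisibility over the fraction field descends to `R`; the unit leading
  -- coefficient permits this normalisation.
  set D : R[X] := Polynomial.C ((u⁻¹ : Rˣ) : R) * A with hD
  have hmon : D.Monic := by
    rw [Monic, hD, leadingCoeff_mul, leadingCoeff_C, ← hu, Units.inv_mul]
  have hu' : IsUnit (Polynomial.C ((u⁻¹ : Rˣ) : R)) := (u⁻¹).isUnit.map Polynomial.C
  have hu'' := hu'.map (mapRingHom (algebraMap R (FractionRing R)))
  rw [coe_mapRingHom] at hu''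
  rw [← hu'.mul_left_dvd, ← hD, ← map_dvd_map (algebraMap R (FractionRing R))
    (IsFractionRing.injective R (FractionRing R)) hmon, hD, Polynomial.map_mul,
    hu''.mul_left_dvd]
  refine IsCoprime.dvd_of_dvd_mul_left h ?_
  rw [← Polynomial.map_mul]
  exact Polynomial.map_dvd _ hd

/-- Over the fraction field the 2 × 2 system is invertible, with determinant `± (t ^ j - t ^ k)`, so
`U` and `V` are linear combinations of the two given ones and a Bézout relation carries over. -/
theorem cop_combination {t : Rˣ} {j k : ℤ} (hjk : t ^ j ≠ t ^ k) {U V : R[X]} (h : Cop U V) :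
    Cop (U + mon t j * V) (U + mon t k * V) := by
  set ι := algebraMap R (FractionRing R)
  have hne : ι (t ^ j : Rˣ) - ι (t ^ k : Rˣ) ≠ 0 := by
    intro h0
    exact hjk (Units.ext (IsFractionRing.injective R (FractionRing R) (sub_eq_zero.1 h0)))
  obtain ⟨r, s, hrs⟩ := h
  rw [Cop]
  simp only [Polynomial.map_add, Polynomial.map_mul, mon, map_C]
  set e := ι (t ^ j : Rˣ)
  set f := ι (t ^ k : Rˣ)
  have hinv : (C ((e - f)⁻¹) : (FractionRing R)[X]) * (C e - C f) = 1 := by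
    rw [← C_sub, ← C_mul, inv_mul_cancel₀ hne, C_1]
  refine ⟨C ((e - f)⁻¹) * (s - C f * r), C ((e - f)⁻¹) * (C e * r - s), ?_⟩
  linear_combination (r * U.map ι + s * V.map ι) * hinv + hrs

end Coprime

/-! ### Good triangles and their stability under reflection -/

section Good

variable {R : Type*} [CommRing R]

/-- Coprimality of the polynomials at two vertices, and of one of them with the time shift of
the other. -/
structure Pair (t : Rˣ) (A B : R[X]) : Prop where
  cop : Cop A B
  left : Cop (sh t A) B
  right : Cop A (sh t B)

theorem Pair.symm {t : Rˣ} {A B : R[X]} (h : Pair t A B) : Pair t B A :=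
  ⟨h.cop.symm, h.right.symm, h.left.symm⟩

/-- The properties of a single polynomial at a vertex of degree `a`. -/
structure Vert (t : Rˣ) (A : R[X]) (a : ℤ) : Prop where
  monic : A.Monic
  deg : (A.natDegree : ℤ) = a
  coeff : A.coeff 0 = 1
  cop : Cop A (sh t A)

/-- The reflection of `A` across the side `B, C` is a polynomial. -/
def Div (t : Rˣ) (A B C : R[X]) (a b : ℤ) : Prop :=
  sh t A ∣ B * sh t C + mon t (a - b) * X * (sh t B * C)

/-- The triangles that are reached from `1, 1, 1` by reflections. -/
structure Good (t : Rˣ) (A B C : R[X]) (a b c : ℤ) : Prop where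
  vA : Vert t A a
  vB : Vert t B b
  vC : Vert t C c
  AB : Pair t A B
  BC : Pair t B C
  CA : Pair t C A
  iC : TriId t A B C a b c
  iA : TriId t B C A b c a
  iB : TriId t C A B c a b
  dA : Div t A B C a b
  dB : Div t B C A b c
  dC : Div t C A B c a
  mod : ¬ (3 : ℤ) ∣ a + b + c + 1

variable {t : Rˣ} {A N B C : R[X]} {a b c : ℤ}

theorem Good.rot (h : Good t A B C a b c) : Good t B C A b c a :=
  ⟨h.vB, h.vC, h.vA, h.BC, h.CA, h.AB, h.iA, h.iB, h.iC, h.dB, h.dC, h.dA, by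
    have := h.mod
    rwa [show b + c + a + 1 = a + b + c + 1 by ring]⟩

theorem good_one : Good t 1 1 1 0 0 0 := by
  have v : Vert t (1 : R[X]) 0 := ⟨monic_one, by simp, by simp, by simpa using cop_one 1⟩
  have p : Pair t (1 : R[X]) 1 := by
    constructor <;> simpa using cop_one 1
  have i : TriId t (1 : R[X]) 1 1 0 0 0 := by simp [TriId, lam]
  have d : Div t (1 : R[X]) 1 1 0 0 := by simp [Div]
  exact ⟨v, v, v, p, p, p, i, i, i, d, d, d, by norm_num⟩

theorem Vert.sh_coeff (h : Vert t A a) : (sh t A).coeff 0 = 1 := by simp [h.coeff]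

theorem Vert.isUnit_leadingCoeff (h : Vert t A a) : IsUnit (sh t A).leadingCoeff := by
  rw [leadingCoeff_sh, h.monic.leadingCoeff, one_mul]
  exact (t ^ _).isUnit

theorem Vert.leadingCoeff_sh (h : Vert t A a) : (sh t A).leadingCoeff = ((t ^ a : Rˣ) : R) := by
  rw [QP4.leadingCoeff_sh, h.monic.leadingCoeff, one_mul, ← h.deg]
  simp

variable [IsDomain R]

theorem Good.exists_refl (h : Good t A B C a b c) : ∃ N, Refl t A N B C a b c := by
  obtain ⟨N, hN⟩ := h.dA
  exact ⟨N, .of_right h.vA.coeff h.vB.coeff h.vC.coeff h.iC h.iA h.iB hN.symm⟩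

theorem Vert.ne_zero (h : Vert t A a) : A ≠ 0 := h.monic.ne_zero

theorem Vert.sh_ne_zero (h : Vert t A a) : sh t A ≠ 0 := ne_zero_of_coeff_zero h.sh_coeff

/-- In the right relation the summand with the factor `X` has degree one larger than the other, so
it decides degree and leading coefficient, while the other decides the constant term. The exponent
`a - b` is exactly what makes `N` monic: `sh t B` contributes `t ^ b` and `sh t A` has leading
coefficient `t ^ a`. -/
theorem Refl.degrees (h : Refl t A N B C a b c) (vA : Vert t A a) (vB : Vert t B b)
    (vC : Vert t C c) : N.Monic ∧ (N.natDegree : ℤ) = b + c + 1 - a ∧ N.coeff 0 = 1 := by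
  have h' := h.right
  set V := mon t (a - b) * X * (sh t B * C)
  have hV : V ≠ 0 := mul_ne_zero (mul_ne_zero (mon_ne_zero _ _) X_ne_zero)
    (mul_ne_zero vB.sh_ne_zero vC.ne_zero)
  have hVd : V.natDegree = B.natDegree + C.natDegree + 1 := by
    rw [natDegree_mul (mul_ne_zero (mon_ne_zero _ _) X_ne_zero)
      (mul_ne_zero vB.sh_ne_zero vC.ne_zero), natDegree_mul (mon_ne_zero _ _) X_ne_zero,
      natDegree_mul vB.sh_ne_zero vC.ne_zero, natDegree_sh, mon, natDegree_C, natDegree_X]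
    ring
  have hUd : (B * sh t C).natDegree = B.natDegree + C.natDegree := by
    rw [natDegree_mul vB.ne_zero vC.sh_ne_zero, natDegree_sh]
  have hlt : (B * sh t C).degree < V.degree := by
    rw [degree_eq_natDegree hV, degree_eq_natDegree (mul_ne_zero vB.ne_zero vC.sh_ne_zero), hVd,
      hUd]
    exact_mod_cast Nat.lt_succ_self _
  have hlead : (sh t A * N).leadingCoeff = V.leadingCoeff := by
    rw [h', leadingCoeff_add_of_degree_lt hlt]
  have hdeg : (sh t A * N).natDegree = V.natDegree := by
    rw [h', natDegree_add_eq_right_of_degree_lt hlt]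
  have hcoef := congrArg (fun P => coeff P 0) h'
  simp only [coeff_add, mul_coeff_zero, vA.sh_coeff, vB.coeff, vC.sh_coeff, V, coeff_X_zero,
    mul_zero, zero_mul, add_zero, mul_one, one_mul] at hcoef
  have hN : N ≠ 0 := ne_zero_of_coeff_zero hcoef
  refine ⟨?_, ?_, hcoef⟩
  · have e : V.leadingCoeff = ((t ^ a : Rˣ) : R) := by
      simp only [V, leadingCoeff_mul, mon, leadingCoeff_C, leadingCoeff_X,
        vB.leadingCoeff_sh, vC.monic.leadingCoeff, mul_one]
      rw [← Units.val_mul, ← zpow_add, sub_add_cancel]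
    rw [leadingCoeff_mul, e, vA.leadingCoeff_sh] at hlead
    exact (t ^ a).isUnit.mul_eq_left.1 hlead
  · rw [natDegree_mul vA.sh_ne_zero hN, natDegree_sh, hVd] at hdeg
    have := vA.deg
    have := vB.deg
    have := vC.deg
    omega

/-- The coprimality relations of the reflected vertex. -/
theorem Good.refl_cop (ht : ∀ k : ℤ, t ^ k = 1 → k = 0) (h : Good t A B C a b c)
    (hN : Refl t A N B C a b c) : Cop N (sh t N) ∧ Pair t N B ∧ Pair t C N := by
  obtain ⟨hl, hr⟩ := hN
  have hXB := cop_X h.vB.coeff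
  have hXC := cop_X h.vC.coeff
  have hXB' := cop_X h.vB.sh_coeff
  have hXC' := cop_X h.vC.sh_coeff
  have hBC' := h.BC.cop.sh t
  -- Each of `B`, `sh t B`, `C`, `sh t C` divides one summand and is coprime to the other. This
  -- applies with `M = N` and with `M = sh t N`.
  have key : ∀ k, ∀ M D : R[X], D * M = B * sh t C + mon t k * X * (sh t B * C) →
      Cop B M ∧ Cop (sh t B) M ∧ Cop C M ∧ Cop (sh t C) M := by
    intro k M D hM
    refine ⟨.of_mul_right (B := D) ?_, .of_mul_right (B := D) ?_, .of_mul_right (B := D) ?_,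
      .of_mul_right (B := D) ?_⟩ <;> rw [hM]
    · exact .add_of_dvd (((cop_mon _ _ _).mul_right hXB).mul_right
        (h.vB.cop.mul_right h.BC.cop)) (dvd_mul_right _ _)
    · rw [add_comm]
      exact .add_of_dvd (h.vB.cop.symm.mul_right hBC')
        (dvd_mul_of_dvd_right (dvd_mul_right _ _) _)
    · rw [add_comm]
      exact .add_of_dvd (h.BC.cop.symm.mul_right h.vC.cop)
        (dvd_mul_of_dvd_right (dvd_mul_left _ _) _)
    · exact .add_of_dvd (((cop_mon _ _ _).mul_right hXC').mul_right
        (hBC'.symm.mul_right h.vC.cop.symm)) (dvd_mul_left _ _)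
  obtain ⟨r₁, r₂, r₃, r₄⟩ := key _ _ _ hr
  obtain ⟨l₁, l₂, l₃, l₄⟩ := key _ _ _ hl
  refine ⟨?_, ⟨r₁.symm, l₁.symm, r₂.symm⟩, ⟨r₃, r₄, l₃⟩⟩
  have hUV : Cop (B * sh t C) (X * (sh t B * C)) :=
    Cop.mul_right (hXB.symm.mul_right hXC'.symm).symm
      (Cop.mul_right (h.vB.cop.symm.mul_right hBC').symm
        (h.BC.cop.symm.mul_right h.vC.cop).symm)
  -- The exponents differ by `2a - b - c - 1 = 3a - (a + b + c + 1)`, which is nonzero by the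
  -- condition modulo 3. The two reflection relations are then distinct combinations of the same
  -- coprime pair, and so their factors `N` and `sh t N` are coprime.
  have hjk : t ^ (a - b) ≠ t ^ (1 + c - a) := by
    intro he
    have h1 : t ^ ((a - b) - (1 + c - a)) = 1 := by rw [zpow_sub, he, mul_inv_cancel]
    have h2 := ht _ h1
    exact h.mod ⟨a, by omega⟩
  have := cop_combination hjk hUV
  rw [← mul_assoc (mon t (a - b)), ← mul_assoc (mon t (1 + c - a)), ← hl, ← hr] at this
  exact (this.of_mul_right.symm.of_mul_right).symm

theorem Good.reflect (ht : ∀ k : ℤ, t ^ k = 1 → k = 0) (h : Good t A B C a b c)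
    (hN : Refl t A N B C a b c) : Good t N B C (b + c + 1 - a) b c := by
  obtain ⟨m, d, k⟩ := hN.degrees h.vA h.vB h.vC
  obtain ⟨cN, pB, pC⟩ := h.refl_cop ht hN
  have hAA : A * sh t A ≠ 0 := mul_ne_zero h.vA.ne_zero h.vA.sh_ne_zero
  refine ⟨⟨m, d, k, cN⟩, h.vB, h.vC, pB, h.BC, pC, h.iC.reflect_fst h.vA.coeff hN,
    TriId.reflect_thd h.vA.coeff hN h.iC h.iB, h.iB.reflect_snd h.vA.coeff hN, ?_, ?_, ?_, ?_⟩
  · rw [Div, ← hN.symm.right]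
    exact dvd_mul_right _ _
  -- Modulo `sh t B`, both `A * sh t N` and `sh t A * N` reduce to `B * sh t C`. Hence `A * sh t A`
  -- times the new expression is a multiple of the old one, and `A * sh t A` can be cancelled by
  -- coprimality.
  · refine Cop.dvd_of_dvd_mul_left (B := A * sh t A) h.vB.isUnit_leadingCoeff
      (h.AB.right.symm.mul_right (h.AB.cop.symm.sh t)) ?_
    have := h.dB
    rw [Div] at this
    have e : A * sh t A * (C * sh t N + mon t (b - c) * X * (sh t C * N)) =
        B * sh t C * (C * sh t A + mon t (b - c) * X * (sh t C * A)) +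
          sh t B * (C * sh t A * (mon t (1 + c - a) * X * C) +
            mon t (b - c) * X * sh t C * A * (mon t (a - b) * X * C)) := by
      linear_combination C * sh t A * hN.left + mon t (b - c) * X * sh t C * A * hN.right
    rw [e]
    exact dvd_add (dvd_mul_of_dvd_right this _) (dvd_mul_right _ _)
  -- The same argument modulo `sh t C`, where the summands containing `X * sh t B * C` are the ones
  -- that survive.
  · refine Cop.dvd_of_dvd_mul_left (B := A * sh t A) h.vC.isUnit_leadingCoeff
      (h.CA.left.mul_right (h.CA.cop.sh t)) ?_
    have := h.dC
    rw [Div] at this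
    have e₁ : mon t (c - (b + c + 1 - a)) * mon t (1 + c - a) =
        mon t (a - b) * mon t (c - a) := by
      rw [← mon_add, ← mon_add]; congr 1; ring
    have e : A * sh t A * (N * sh t B + mon t (c - (b + c + 1 - a)) * X * (sh t N * B)) =
        mon t (a - b) * X * sh t B * C * (A * sh t B + mon t (c - a) * X * (sh t A * B)) +
          sh t C * (A * sh t B * B +
            mon t (c - (b + c + 1 - a)) * X * sh t A * B * B) := by
      linear_combination A * sh t B * hN.right +
        mon t (c - (b + c + 1 - a)) * X * sh t A * B * hN.left +
        X ^ 2 * sh t A * B * sh t B * C * e₁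
    rw [e]
    exact dvd_add (dvd_mul_of_dvd_right this _) (dvd_mul_right _ _)
  -- The new sum is twice the old one minus `3a`, so it stays prime to 3.
  · have := h.mod
    omega

end Good

/-! ### The braid relation as polynomial identities -/

section Braid

variable {R : Type*} [CommRing R] [IsDomain R] {t : Rˣ}
  {A B C N B₁ N₂ M A₁ M₂ : R[X]} {a b c : ℤ}

/-- The first half of the braid relation for the reflections around the vertex `C`. -/
theorem Refl.hexagon_fst (hA : A.coeff 0 = 1) (hB : B.coeff 0 = 1) (hN : N.coeff 0 = 1)
    (h₀ : Refl t A N B C a b c) (h₁ : Refl t B B₁ C N b c (b + c + 1 - a))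
    (h₂ : Refl t N N₂ B₁ C (b + c + 1 - a) (c + (b + c + 1 - a) + 1 - b) c)
    (g₁ : Refl t B M C A b c a) (g₀ : Refl t A A₁ M C a (c + a + 1 - b) c) : N₂ = A₁ := by
  have nz : ∀ {P : R[X]}, P.coeff 0 = 1 → P * sh t P ≠ 0 := fun h =>
    mul_ne_zero (ne_zero_of_coeff_zero h) (ne_zero_of_coeff_zero (by simpa using h))
  have hN' : sh t N ≠ 0 := ne_zero_of_coeff_zero (by simpa using hN)
  -- This factor clears all divisions on both routes: `B₁` and `M` can be eliminated, and the
  -- relations between `A` and `N` make the two results agree.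
  refine mul_left_cancel₀ (mul_ne_zero (mul_ne_zero (nz hA) (nz hB)) hN') ?_
  have i₂ := h₂.right
  have j₀ := g₀.right
  obtain ⟨l₀, r₀⟩ := h₀
  obtain ⟨l₁, r₁⟩ := h₁
  obtain ⟨m₁, s₁⟩ := g₁
  rw [show b + c + 1 - a - (c + (b + c + 1 - a) + 1 - b) = b - c - 1 by ring] at i₂
  rw [show a - (c + a + 1 - b) = b - c - 1 by ring] at j₀
  have e₁ : mon t (b - c - 1) * mon t (1 + (b + c + 1 - a) - b) =
      mon t (b - c) * mon t (1 + c - a) := by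
    rw [← mon_add, ← mon_add]; congr 1; ring
  have e₂ : mon t (b - c - 1) * mon t (1 + a - b) = mon t (b - c) * mon t (a - b) := by
    rw [← mon_add, ← mon_add]; congr 1; ring
  set k := mon t (b - c - 1)
  set m := mon t (1 + (b + c + 1 - a) - b)
  set f := mon t (b - c)
  set p := mon t (1 + a - b)
  set e := mon t (a - b)
  set d := mon t (1 + c - a)
  linear_combination A * sh t A * B * sh t B * i₂ + A * sh t A * B * sh t C * r₁ +
    A * sh t A * k * X * sh t B * C * l₁ - A * B * sh t B * sh t N * j₀ -
    A * sh t N * B * sh t C * s₁ - A * sh t N * k * X * sh t B * C * m₁ -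
    (f * X * sh t C ^ 2 * A * B + k * p * X ^ 2 * sh t B * C * sh t C * A) * l₀ +
    (f * X * sh t C ^ 2 * A * B + k * m * X ^ 2 * sh t B * C * sh t C * A) * r₀ +
    X ^ 2 * A * sh t B * C * sh t C * (B * sh t C + e * X * sh t B * C) * e₁ -
    X ^ 2 * A * sh t B * C * sh t C * (B * sh t C + d * X * sh t B * C) * e₂

/-- The second half of the braid relation for the reflections around the vertex `C`. -/
theorem Refl.hexagon_snd (hA : A.coeff 0 = 1) (hB : B.coeff 0 = 1) (hM : M.coeff 0 = 1)
    (h₀ : Refl t A N B C a b c) (h₁ : Refl t B B₁ C N b c (b + c + 1 - a))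
    (g₁ : Refl t B M C A b c a) (g₀ : Refl t A A₁ M C a (c + a + 1 - b) c)
    (g₂ : Refl t M M₂ C A₁ (c + a + 1 - b) c ((c + a + 1 - b) + c + 1 - a)) : B₁ = M₂ := by
  have nz : ∀ {P : R[X]}, P.coeff 0 = 1 → P * sh t P ≠ 0 := fun h =>
    mul_ne_zero (ne_zero_of_coeff_zero h) (ne_zero_of_coeff_zero (by simpa using h))
  have hM' : sh t M ≠ 0 := ne_zero_of_coeff_zero (by simpa using hM)
  refine mul_left_cancel₀ (mul_ne_zero (mul_ne_zero (nz hA) (nz hB)) hM') ?_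
  have j₂ := g₂.right
  have i₁ := h₁.right
  obtain ⟨l₀, r₀⟩ := h₀
  obtain ⟨u₀, v₀⟩ := g₀
  obtain ⟨m₁, s₁⟩ := g₁
  rw [show c + a + 1 - b - c = 1 + a - b by ring] at j₂
  rw [show a - (c + a + 1 - b) = b - c - 1 by ring] at v₀
  have e₂ : mon t (b - c - 1) * mon t (1 + a - b) = mon t (b - c) * mon t (a - b) := by
    rw [← mon_add, ← mon_add]; congr 1; ring
  set k := mon t (b - c - 1)
  set f := mon t (b - c)
  set p := mon t (1 + a - b)
  set e := mon t (a - b)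
  set d := mon t (1 + c - a)
  linear_combination A * sh t A * B * sh t M * i₁ +
    (sh t A * C * (A * sh t N) + f * X * sh t C * A * (sh t A * N)) * m₁ +
    sh t A * C * (C * sh t A + p * X * sh t C * A) * l₀ +
    f * X * sh t C * A * (C * sh t A + p * X * sh t C * A) * r₀ -
    A * sh t A * B * sh t B * j₂ - B * sh t B * sh t A * C * u₀ -
    B * sh t B * p * X * sh t C * A * v₀ -
    (sh t A * C * B * sh t C + p * X * sh t C * A * B * sh t C) * s₁ -
    (sh t A * C * d * X * sh t B * C + p * X * sh t C * A * k * X * sh t B * C) * m₁ -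
    X ^ 2 * sh t B * C * sh t C * A * (C * sh t A + p * X * sh t C * A) * e₂

end Braid

/-! ### The group action on good triangles -/

section States

variable {R : Type*} [CommRing R] [IsDomain R]

/-- A good triangle. -/
@[ext]
structure Tri (t : Rˣ) where
  A : R[X]
  B : R[X]
  C : R[X]
  a : ℤ
  b : ℤ
  c : ℤ
  good : Good t A B C a b c

variable {t : Rˣ}

/-- The triangle `1, 1, 1`. -/
def Tri.base (t : Rˣ) : Tri t := ⟨1, 1, 1, 0, 0, 0, good_one⟩

/-- The rotation of a triangle. -/
def rotPerm (t : Rˣ) : Equiv.Perm (Tri t) where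
  toFun v := ⟨v.B, v.C, v.A, v.b, v.c, v.a, v.good.rot⟩
  invFun v := ⟨v.C, v.A, v.B, v.c, v.a, v.b, v.good.rot.rot⟩
  left_inv _ := rfl
  right_inv _ := rfl

/-- The reflection of the first vertex of a triangle. -/
def Tri.reflect (ht : ∀ k : ℤ, t ^ k = 1 → k = 0) (v : Tri t) : Tri t :=
  ⟨v.good.exists_refl.choose, v.B, v.C, v.b + v.c + 1 - v.a, v.b, v.c,
    v.good.reflect ht v.good.exists_refl.choose_spec⟩

variable (ht : ∀ k : ℤ, t ^ k = 1 → k = 0)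

theorem Tri.refl_reflect (v : Tri t) :
    Refl t v.A (v.reflect ht).A v.B v.C v.a v.b v.c :=
  v.good.exists_refl.choose_spec

theorem Tri.reflect_involutive : Function.Involutive (Tri.reflect ht) := by
  intro v
  ext1
  · exact ((v.reflect ht).refl_reflect ht).unique (v.reflect ht).good.vA.coeff
      (v.refl_reflect ht).symm
  · rfl
  · rfl
  · simp [Tri.reflect]
  · rfl
  · rfl

/-- The reflection of the first vertex, as a permutation. -/
def reflPerm : Equiv.Perm (Tri t) := (Tri.reflect_involutive ht).toPerm

theorem reflPerm_mul_self : reflPerm ht * reflPerm ht = 1 :=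
  Equiv.ext (Tri.reflect_involutive ht)

/-- Alternating reflections of the first two vertices keep `C` fixed and run around a hexagon
centred at it. The two routes to the opposite triangle are compared vertex by vertex in the hexagon
lemmas; the degrees agree by arithmetic. -/
theorem braid : reflPerm ht * ((rotPerm t)⁻¹ * reflPerm ht * rotPerm t) * reflPerm ht =
    ((rotPerm t)⁻¹ * reflPerm ht * rotPerm t) * reflPerm ht *
      ((rotPerm t)⁻¹ * reflPerm ht * rotPerm t) := by
  ext1 v
  set r := rotPerm t
  have h₀ := v.refl_reflect ht
  have h₁ := (r (v.reflect ht)).refl_reflect ht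
  have h₂ := (r⁻¹ ((r (v.reflect ht)).reflect ht)).refl_reflect ht
  have g₁ := (r v).refl_reflect ht
  have g₀ := (r⁻¹ ((r v).reflect ht)).refl_reflect ht
  have g₂ := (r ((r⁻¹ ((r v).reflect ht)).reflect ht)).refl_reflect ht
  ext1
  · exact Refl.hexagon_fst v.good.vA.coeff v.good.vB.coeff (v.reflect ht).good.vA.coeff
      h₀ h₁ h₂ g₁ g₀
  · exact Refl.hexagon_snd v.good.vA.coeff v.good.vB.coeff ((r v).reflect ht).good.vA.coeff
      h₀ h₁ g₁ g₀ g₂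
  · rfl
  · change v.c + (v.b + v.c + 1 - v.a) + 1 - v.b + v.c + 1 - (v.b + v.c + 1 - v.a) =
      v.c + v.a + 1 - v.b + v.c + 1 - v.a
    ring
  · change v.c + (v.b + v.c + 1 - v.a) + 1 - v.b =
      v.c + (v.c + v.a + 1 - v.b + v.c + 1 - v.a) + 1 - (v.c + v.a + 1 - v.b)
    ring
  · rfl

/-- The permutations of the triangles that correspond to the generators. -/
def genPerm : Gen → Equiv.Perm (Tri t)
  | .s i => ![reflPerm ht, (rotPerm t)⁻¹ * reflPerm ht * rotPerm t,
      rotPerm t * reflPerm ht * (rotPerm t)⁻¹] i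
  | .rot => rotPerm t
  | .rotInv => (rotPerm t)⁻¹

theorem genPerm_inv (g : Gen) : genPerm ht g.inv = (genPerm ht g)⁻¹ := by
  have hs : (reflPerm ht)⁻¹ = reflPerm ht := inv_eq_of_mul_eq_one_left (reflPerm_mul_self ht)
  cases g with
  | s i => fin_cases i <;> simp [genPerm, Gen.inv, hs, mul_assoc]
  | rot => rfl
  | rotInv => simp [genPerm, Gen.inv]

/-- The permutation for a word; the letters are used from left to right. -/
def wordPerm : List Gen → Equiv.Perm (Tri t)
  | [] => 1
  | g :: w => wordPerm w * genPerm ht g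

theorem wordPerm_append (w w' : List Gen) :
    wordPerm ht (w ++ w') = wordPerm ht w' * wordPerm ht w := by
  induction w with
  | nil => simp [wordPerm]
  | cons g w ih => simp [wordPerm, ih, mul_assoc]

theorem wordPerm_wordInv (w : List Gen) : wordPerm ht (wordInv w) = (wordPerm ht w)⁻¹ := by
  induction w with
  | nil => simp [wordPerm, wordInv]
  | cons g w ih =>
    rw [wordInv] at ih
    simp [wordInv, wordPerm, wordPerm_append, ih, genPerm_inv]

theorem wordPerm_replicate (w : List Gen) (k : ℕ) :
    wordPerm ht (List.replicate k w).flatten = wordPerm ht w ^ k := by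
  induction k with
  | zero => simp [wordPerm]
  | succ k ih => simp [List.replicate_succ, wordPerm_append, ih, pow_succ]

theorem wordPerm_wordZPow (w : List Gen) (k : ℤ) :
    wordPerm ht (wordZPow w k) = wordPerm ht w ^ k := by
  cases k with
  | ofNat k => simp [wordZPow, wordPerm_replicate]
  | negSucc k => simp [wordZPow, wordPerm_replicate, wordPerm_wordInv, zpow_negSucc]

/-- A computation in the extended affine Weyl group, using only that the rotation has order 3, that
the reflection is an involution, and the braid relation. -/
theorem commute_T : Commute (wordPerm ht (t := t) T₁) (wordPerm ht T₂) := by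
  have hr : rotPerm t * rotPerm t = (rotPerm t)⁻¹ := rfl
  have hs := reflPerm_mul_self ht
  have hb := braid ht
  have hw₁ : wordPerm ht (t := t) T₁ =
      (rotPerm t)⁻¹ * reflPerm ht * (rotPerm t)⁻¹ * reflPerm ht := by
    rw [← hr]; rfl
  have hw₂ : wordPerm ht (t := t) T₂ = rotPerm t * reflPerm ht * (rotPerm t)⁻¹ * rotPerm t *
    ((rotPerm t)⁻¹ * reflPerm ht * rotPerm t) := rfl
  rw [Commute, SemiconjBy, hw₁, hw₂]
  set s := reflPerm ht
  set r := rotPerm t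
  have hb' : s * r⁻¹ * s * r * s = r⁻¹ * s * r * s * r⁻¹ * s * r := by
    simpa only [mul_assoc] using hb
  -- Conjugation by the rotation turns the braid relation of `s₀, s₁` into that of `s₂, s₀`.
  have hb'' : s * r * s * r⁻¹ * s = r * s * r⁻¹ * s * r * s * r⁻¹ := by
    have := congrArg (fun x => r * x * r⁻¹) hb'
    have h2 := this.symm
    simp only [mul_assoc, mul_inv_cancel_left, mul_inv_cancel, mul_one] at h2 ⊢
    exact h2
  calc r⁻¹ * s * r⁻¹ * s * (r * s * r⁻¹ * r * (r⁻¹ * s * r))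
      = r⁻¹ * s * r⁻¹ * (s * r * s * r⁻¹ * s) * r := by group
    _ = r⁻¹ * (s * s) * r⁻¹ * s * r * s := by rw [hb'']; group
    _ = r⁻¹ * r⁻¹ * s * r * s := by rw [hs]; group
    _ = r * s * r * s := by
      have h3 : r⁻¹ * r⁻¹ = r := by
        rw [← hr]; rfl
      rw [h3]
    _ = r * s * (r⁻¹ * r⁻¹) * s := by
      have h3 : r⁻¹ * r⁻¹ = r := by
        rw [← hr]; rfl
      rw [h3]
    _ = r * s * r⁻¹ * (s * s) * r⁻¹ * s := by rw [hs]; group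
    _ = r * s * r⁻¹ * r * (r⁻¹ * s * r) * (r⁻¹ * s * r⁻¹ * s) := by group

end States

/-! ### Bäcklund transformations as reflections -/

section Points

variable {K : Type*} [Field K] {p : K}

/-- The time shift factor `p⁻²` as a unit. -/
def timeUnit (hp : p ≠ 0) : Kˣ := Units.mk0 p hp ^ (-2 : ℤ)

theorem polyShift_eq_sh (hp : p ≠ 0) (P : K[X]) : polyShift p P = sh (timeUnit hp) P := by
  simp [polyShift, sh, timeUnit]

theorem mon_timeUnit (hp : p ≠ 0) (k : ℤ) : mon (timeUnit hp) k = C (p ^ (-2 * k)) := by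
  simp [mon, timeUnit, zpow_mul]

theorem algebraMap_mon (hp : p ≠ 0) (k : ℤ) :
    algebraMap K[X] (RatFunc K) (mon (timeUnit hp) k) = RatFunc.C p ^ (-2 * k) := by
  rw [mon_timeUnit, RatFunc.algebraMap_C, map_zpow₀]

/-- The values `a₀, a₁, a₂, f₀, f₁, f₂` attached to a triangle. -/
def triPoint (p : K) (A B C : K[X]) (a b c : ℤ) : Point (RatFunc K) where
  a := fun i => RatFunc.C
    (![p ^ (2 * a - b - c - 1), p ^ (2 * b - c - a - 1), p ^ (2 * c - a - b - 1)] i)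
  f := ![RatFunc.X * RatFunc.C (p ^ (b - c - 1)) * shiftRatio p B C,
    RatFunc.X * RatFunc.C (p ^ (c - a - 1)) * shiftRatio p C A,
    RatFunc.X * RatFunc.C (p ^ (a - b - 1)) * shiftRatio p A B]

theorem triPoint_rot (A B C : K[X]) (a b c : ℤ) :
    Gen.rot.act (triPoint p A B C a b c) = triPoint p B C A b c a := by
  simp only [triPoint, Gen.act, Point.mk.injEq]
  constructor <;> ext1 i <;> fin_cases i <;> rfl

theorem Gen.act_rot_rotInv {L : Type*} [Field L] (P : Point L) :
    Gen.rotInv.act (Gen.rot.act P) = P := by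
  simp [Gen.act]

theorem Gen.act_s_succ {L : Type*} [Field L] (i : Fin 3) (P : Point L) :
    (Gen.s (i + 1)).act P = Gen.rotInv.act ((Gen.s i).act (Gen.rot.act P)) := by
  have hc : ∀ i j : Fin 3, cartan (i + 1) j = cartan i (j - 1) := by decide
  have ho : ∀ i j : Fin 3, orient (i + 1) j = orient i (j - 1) := by decide
  simp [Gen.act, hc, ho]

theorem Gen.regular_s_succ {L : Type*} [Field L] (i : Fin 3) (P : Point L) :
    (Gen.s (i + 1)).Regular P ↔ (Gen.s i).Regular (Gen.rot.act P) := Iff.rfl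

/-- With primes for the time shift, the left relation reads `1 + a₀ f₀ = A N' / (B C')` and the
right one `a₀ + f₀ = a₀ A' N / (B C')`. Their quotient `a₀ A' N / (A N')` is the factor that
exchanges `A` for `N` in `f₁` and `f₂`; nonvanishing is visible from the factored forms. -/
theorem triPoint_s_zero (hp : p ≠ 0) {A N B C : K[X]} {a b c : ℤ} (hA : A.coeff 0 = 1)
    (hN : N.coeff 0 = 1) (hB : B.coeff 0 = 1) (hC : C.coeff 0 = 1)
    (h : Refl (timeUnit hp) A N B C a b c) :
    (Gen.s 0).Regular (triPoint p A B C a b c) ∧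
      (Gen.s 0).act (triPoint p A B C a b c) = triPoint p N B C (b + c + 1 - a) b c := by
  have hl := congrArg (algebraMap K[X] (RatFunc K)) h.left
  have hr := congrArg (algebraMap K[X] (RatFunc K)) h.right
  simp only [map_mul, map_add, algebraMap_mon, RatFunc.algebraMap_X] at hl hr
  have nz : ∀ {P : K[X]}, P.coeff 0 = 1 → algebraMap K[X] (RatFunc K) P ≠ 0 := fun h =>
    RatFunc.algebraMap_ne_zero (ne_zero_of_coeff_zero h)
  have nz' : ∀ {P : K[X]}, P.coeff 0 = 1 →
      algebraMap K[X] (RatFunc K) (sh (timeUnit hp) P) ≠ 0 := fun h =>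
    nz (by simpa using h)
  have hA' := nz' hA
  have hN' := nz' hN
  have hB' := nz' hB
  have hC' := nz' hC
  have hP : RatFunc.C p ≠ 0 := by simpa using hp
  replace hA := nz hA
  replace hN := nz hN
  replace hB := nz hB
  replace hC := nz hC
  simp only [triPoint, shiftRatio, polyShift_eq_sh hp]
  generalize algebraMap K[X] (RatFunc K) (sh (timeUnit hp) A) = A' at *
  generalize algebraMap K[X] (RatFunc K) (sh (timeUnit hp) B) = B' at *
  generalize algebraMap K[X] (RatFunc K) (sh (timeUnit hp) C) = C' at *
  generalize algebraMap K[X] (RatFunc K) (sh (timeUnit hp) N) = N' at *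
  generalize algebraMap K[X] (RatFunc K) A = A at *
  generalize algebraMap K[X] (RatFunc K) B = B at *
  generalize algebraMap K[X] (RatFunc K) C = C at *
  generalize algebraMap K[X] (RatFunc K) N = N at *
  set x : RatFunc K := RatFunc.X
  set P : RatFunc K := RatFunc.C p
  have hden : 1 + P ^ (2 * a - b - c - 1) * (x * P ^ (b - c - 1) * (B' * C / (B * C'))) =
      A * N' / (B * C') := by
    rw [hl, show -2 * (1 + c - a) = (2 * a - b - c - 1) + (b - c - 1) by ring, zpow_add₀ hP]
    field_simp
  have hnum : P ^ (2 * a - b - c - 1) + x * P ^ (b - c - 1) * (B' * C / (B * C')) =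
      P ^ (2 * a - b - c - 1) * (A' * N / (B * C')) := by
    have e : P ^ (b - c - 1) = P ^ (2 * a - b - c - 1) * P ^ (-2 * (a - b)) := by
      rw [← zpow_add₀ hP]; congr 1; ring
    rw [hr, e]
    field_simp
  have hratio : (P ^ (2 * a - b - c - 1) + x * P ^ (b - c - 1) * (B' * C / (B * C'))) /
      (1 + P ^ (2 * a - b - c - 1) * (x * P ^ (b - c - 1) * (B' * C / (B * C')))) =
      P ^ (2 * a - b - c - 1) * (A' * N / (A * N')) := by
    rw [hden, hnum]
    field_simp
  constructor
  · refine ⟨?_, ?_, ?_⟩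
    · simp [hp, zpow_ne_zero]
    · simp only [Matrix.cons_val_zero, map_zpow₀]
      change P ^ (2 * a - b - c - 1) + x * P ^ (b - c - 1) * (B' * C / (B * C')) ≠ 0
      rw [hnum]
      positivity
    · simp only [Matrix.cons_val_zero, map_zpow₀]
      change 1 + P ^ (2 * a - b - c - 1) * (x * P ^ (b - c - 1) * (B' * C / (B * C'))) ≠ 0
      rw [hden]
      positivity
  · simp only [Gen.act, Point.mk.injEq]
    have ha : ∀ j k l : ℤ, j + k * (2 * a - b - c - 1) = l →
        RatFunc.C (p ^ j) * RatFunc.C (p ^ (2 * a - b - c - 1)) ^ k = RatFunc.C (p ^ l) := by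
      intro j k l h
      rw [← h, ← map_zpow₀, ← map_mul, ← zpow_mul, ← zpow_add₀ hp, mul_comm k]
    constructor
    · ext1 j
      fin_cases j
      · exact ha _ _ _ (by simp [cartan]; ring)
      · exact ha _ _ _ (by simp [cartan]; ring)
      · exact ha _ _ _ (by simp [cartan]; ring)
    · simp only [Matrix.cons_val_zero, map_zpow₀]
      change (fun j => _ * ((P ^ (2 * a - b - c - 1) + x * P ^ (b - c - 1) * (B' * C / (B * C'))) /
        (1 + P ^ (2 * a - b - c - 1) * (x * P ^ (b - c - 1) * (B' * C / (B * C'))))) ^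
          orient 0 j) = _
      rw [hratio]
      ext1 j
      fin_cases j
      · change _ * _ ^ (0 : ℤ) = _
        rw [zpow_zero, mul_one]
        rfl
      · change x * P ^ (c - a - 1) * (C' * A / (C * A')) * _ ^ (1 : ℤ) =
          x * P ^ (c - (b + c + 1 - a) - 1) * (C' * N / (C * N'))
        rw [zpow_one, show c - (b + c + 1 - a) - 1 = (c - a - 1) + (2 * a - b - c - 1) by ring,
          zpow_add₀ hP]
        field_simp
      · change x * P ^ (a - b - 1) * (A' * B / (A * B')) * _ ^ (-1 : ℤ) =
          x * P ^ (b + c + 1 - a - b - 1) * (N' * B / (N * B'))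
        rw [zpow_neg_one, show a - b - 1 = (b + c + 1 - a - b - 1) + (2 * a - b - c - 1) by ring,
          zpow_add₀ hP]
        field_simp

end Points

/-! ### Evaluation of words at the point of a triangle -/

section Words

variable {K : Type*} [Field K] {p : K} {R : Type*} [CommRing R] {t : Rˣ}

/-- The point attached to a triangle over the coefficient ring `R`. -/
def Tri.point (p : K) (ψ : R →+* K) (v : Tri t) : Point (RatFunc K) :=
  triPoint p (v.A.map ψ) (v.B.map ψ) (v.C.map ψ) v.a v.b v.c

theorem Tri.point_rot (ψ : R →+* K) (v : Tri t) :
    Gen.rot.act (v.point p ψ) = (rotPerm t v).point p ψ := triPoint_rot _ _ _ _ _ _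

theorem Tri.point_rotInv (ψ : R →+* K) (v : Tri t) :
    Gen.rotInv.act (v.point p ψ) = ((rotPerm t)⁻¹ v).point p ψ := by
  conv_lhs => rw [show v = rotPerm t ((rotPerm t)⁻¹ v) from rfl, ← Tri.point_rot]
  exact Gen.act_rot_rotInv _

theorem Tri.point_base (ψ : R →+* K) : (Tri.base t).point p ψ = seed p := by
  simp only [Tri.point, Tri.base, triPoint, seed, shiftRatio, polyShift, Point.mk.injEq]
  constructor <;> ext1 i <;> fin_cases i <;> simp

variable [IsDomain R] (ht : ∀ k : ℤ, t ^ k = 1 → k = 0)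

theorem Tri.point_s_zero (hp : p ≠ 0) {ψ : R →+* K}
    (hψ : Units.map ψ.toMonoidHom t = timeUnit hp) (v : Tri t) :
    (Gen.s 0).Regular (v.point p ψ) ∧
      (Gen.s 0).act (v.point p ψ) = (reflPerm ht v).point p ψ := by
  have nz : ∀ {P : R[X]}, P.coeff 0 = 1 → (P.map ψ).coeff 0 = 1 := fun h => by simp [h]
  have := (v.refl_reflect ht).map ψ
  rw [hψ] at this
  exact triPoint_s_zero hp (nz v.good.vA.coeff) (nz (v.reflect ht).good.vA.coeff)
    (nz v.good.vB.coeff) (nz v.good.vC.coeff) this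

theorem Tri.point_gen (hp : p ≠ 0) {ψ : R →+* K}
    (hψ : Units.map ψ.toMonoidHom t = timeUnit hp) (g : Gen) (v : Tri t) :
    g.Regular (v.point p ψ) ∧ g.act (v.point p ψ) = (genPerm ht g v).point p ψ := by
  have h₁ : ∀ v : Tri t, (Gen.s 1).Regular (v.point p ψ) ∧
      (Gen.s 1).act (v.point p ψ) = (genPerm ht (.s 1) v).point p ψ := by
    intro v
    have h := Tri.point_s_zero ht hp hψ (rotPerm t v)
    rw [← Tri.point_rot] at h
    refine ⟨(Gen.regular_s_succ 0 _).2 h.1, ?_⟩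
    rw [show (1 : Fin 3) = 0 + 1 from rfl, Gen.act_s_succ, h.2, Tri.point_rotInv]
    rfl
  cases g with
  | rot => exact ⟨trivial, Tri.point_rot ψ v⟩
  | rotInv => exact ⟨trivial, Tri.point_rotInv ψ v⟩
  | s i =>
    fin_cases i
    · exact Tri.point_s_zero ht hp hψ v
    · exact h₁ v
    · have h := h₁ (rotPerm t v)
      rw [← Tri.point_rot] at h
      refine ⟨(Gen.regular_s_succ 1 _).2 h.1, ?_⟩
      change (Gen.s (1 + 1)).act _ = _
      rw [Gen.act_s_succ, h.2, Tri.point_rotInv]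
      rfl

theorem Tri.sends (hp : p ≠ 0) {ψ : R →+* K}
    (hψ : Units.map ψ.toMonoidHom t = timeUnit hp) (w : List Gen) (v : Tri t) :
    Sends w (v.point p ψ) ((wordPerm ht w v).point p ψ) := by
  induction w generalizing v with
  | nil => rfl
  | cons g w ih =>
    obtain ⟨hr, ha⟩ := Tri.point_gen ht hp hψ g v
    refine ⟨hr, ?_⟩
    rw [ha]
    exact ih _

end Words

/-! ### The Painlevé equation from the second-shift identities -/

section RationalSolution

variable {K : Type*} [Field K] {p : K}

/-- `RatFunc.eval` substitutes in the reduced fraction, whereas the fraction here need not be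
reduced. The two are compared by shifting the cross-multiplied equation; injectivity of the shift
keeps the denominators nonzero. -/
theorem timeShift_div (hp : p ≠ 0) {P Q : K[X]} (hQ : Q ≠ 0) :
    timeShift p (algebraMap K[X] (RatFunc K) P / algebraMap K[X] (RatFunc K) Q) =
      algebraMap K[X] (RatFunc K) (sh (timeUnit hp) P) /
        algebraMap K[X] (RatFunc K) (sh (timeUnit hp) Q) := by
  have h₀ : ∀ S : K[X], S.eval₂ (algebraMap K (RatFunc K))
      (RatFunc.C (p ^ (-2 : ℤ)) * RatFunc.X) = algebraMap K[X] (RatFunc K)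
        (sh (timeUnit hp) S) := by
    intro S
    rw [← polyShift_eq_sh, polyShift, comp, hom_eval₂]
    congr 1
    simp
  have hS : ∀ S : K[X], S ≠ 0 → sh (timeUnit hp) S ≠ 0 := fun S h =>
    (map_ne_zero_iff _ (sh_injective _)).2 h
  rw [timeShift, RatFunc.eval, h₀, h₀, div_eq_div_iff
    (RatFunc.algebraMap_ne_zero (hS _ (RatFunc.denom_ne_zero _)))
    (RatFunc.algebraMap_ne_zero (hS _ hQ)), ← map_mul, ← map_mul, ← map_mul, ← map_mul,
    (RatFunc.num_mul_eq_mul_denom_iff hQ).2 rfl]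

theorem timeShift_shiftRatio (hp : p ≠ 0) {A B : K[X]} (hA : A.coeff 0 = 1)
    (hB : B.coeff 0 = 1) (k : ℤ) :
    timeShift p (RatFunc.X * RatFunc.C (p ^ k) * shiftRatio p A B) =
      RatFunc.X * RatFunc.C (p ^ (k - 2)) *
        shiftRatio p (sh (timeUnit hp) A) (sh (timeUnit hp) B) := by
  have hA' := ne_zero_of_coeff_zero hA
  have hB' : sh (timeUnit hp) B ≠ 0 := ne_zero_of_coeff_zero (by simpa using hB)
  have e : RatFunc.X * RatFunc.C (p ^ k) * shiftRatio p A B =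
      algebraMap K[X] (RatFunc K) (X * C (p ^ k) * (sh (timeUnit hp) A * B)) /
        algebraMap K[X] (RatFunc K) (A * sh (timeUnit hp) B) := by
    simp only [shiftRatio, polyShift_eq_sh hp, map_mul, RatFunc.algebraMap_X,
      RatFunc.algebraMap_C]
    ring
  have hC : sh (timeUnit hp) (C (p ^ k)) = C (p ^ k) := by simp [sh]
  rw [e, timeShift_div hp (mul_ne_zero hA' hB')]
  simp only [shiftRatio, polyShift_eq_sh hp, map_mul, RatFunc.algebraMap_X, sh_X, hC,
    algebraMap_mon, RatFunc.algebraMap_C, map_zpow₀, mul_one]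
  rw [zpow_sub₀ (by simpa using hp), zpow_neg]
  ring

/-- The time evolution of one of the three functions of a triangle. -/
theorem timeShift_triPoint (hp : p ≠ 0) {A B C : K[X]} {a b c : ℤ} (hA : A.coeff 0 = 1)
    (hB : B.coeff 0 = 1) (hC : C.coeff 0 = 1)
    (h₂ : TriId (timeUnit hp) A B C a b c) (h₁ : TriId (timeUnit hp) C A B c a b) :
    let a₀ := RatFunc.C (p ^ (2 * a - b - c - 1))
    let a₁ := RatFunc.C (p ^ (2 * b - c - a - 1))
    let a₂ := RatFunc.C (p ^ (2 * c - a - b - 1))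
    let f₀ := RatFunc.X * RatFunc.C (p ^ (b - c - 1)) * shiftRatio p B C
    let f₁ := RatFunc.X * RatFunc.C (p ^ (c - a - 1)) * shiftRatio p C A
    let f₂ := RatFunc.X * RatFunc.C (p ^ (a - b - 1)) * shiftRatio p A B
    1 + a₀ * f₀ + a₀ * a₁ * f₀ * f₁ ≠ 0 ∧
      timeShift p f₀ = a₀ * a₁ * f₁ *
        ((1 + a₂ * f₂ + a₂ * a₀ * f₂ * f₀) / (1 + a₀ * f₀ + a₀ * a₁ * f₀ * f₁)) := by
  intro a₀ a₁ a₂ f₀ f₁ f₂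
  have hT : timeShift p f₀ = _ := timeShift_shiftRatio hp hB hC (b - c - 1)
  rw [TriId] at h₁ h₂
  replace h₁ := congrArg (algebraMap K[X] (RatFunc K)) h₁
  replace h₂ := congrArg (algebraMap K[X] (RatFunc K)) h₂
  simp only [map_mul, map_add, map_pow, algebraMap_mon, RatFunc.algebraMap_X] at h₁ h₂
  have nz : ∀ {P : K[X]}, P.coeff 0 = 1 → algebraMap K[X] (RatFunc K) P ≠ 0 := fun h =>
    RatFunc.algebraMap_ne_zero (ne_zero_of_coeff_zero h)
  have nz' : ∀ {P : K[X]}, P.coeff 0 = 1 →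
      algebraMap K[X] (RatFunc K) (sh (timeUnit hp) P) ≠ 0 := fun h =>
    nz (by simpa using h)
  have nz'' : ∀ {P : K[X]}, P.coeff 0 = 1 →
      algebraMap K[X] (RatFunc K) (sh (timeUnit hp) (sh (timeUnit hp) P)) ≠ 0 := fun h =>
    nz (by simpa using h)
  have hA' := nz' hA
  have hB' := nz' hB
  have hC' := nz' hC
  have hB'' := nz'' hB
  have hC'' := nz'' hC
  have hl : algebraMap K[X] (RatFunc K) (lam (timeUnit hp)) ≠ 0 :=
    RatFunc.algebraMap_ne_zero (lam_ne_zero _)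
  have hP : RatFunc.C p ≠ 0 := by simpa using hp
  have hx : (RatFunc.X : RatFunc K) ≠ 0 := RatFunc.X_ne_zero
  replace hA := nz hA
  replace hB := nz hB
  replace hC := nz hC
  rw [hT]
  simp only [a₀, a₁, a₂, f₀, f₁, f₂, shiftRatio, polyShift_eq_sh hp, map_zpow₀]
  generalize algebraMap K[X] (RatFunc K) (sh (timeUnit hp) (sh (timeUnit hp) B)) = B'' at *
  generalize algebraMap K[X] (RatFunc K) (sh (timeUnit hp) (sh (timeUnit hp) C)) = C'' at *
  generalize algebraMap K[X] (RatFunc K) (sh (timeUnit hp) A) = A' at *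
  generalize algebraMap K[X] (RatFunc K) (sh (timeUnit hp) B) = B' at *
  generalize algebraMap K[X] (RatFunc K) (sh (timeUnit hp) C) = C' at *
  generalize algebraMap K[X] (RatFunc K) A = A at *
  generalize algebraMap K[X] (RatFunc K) B = B at *
  generalize algebraMap K[X] (RatFunc K) C = C at *
  generalize algebraMap K[X] (RatFunc K) (lam (timeUnit hp)) = l at *
  generalize (RatFunc.X : RatFunc K) = x at *
  generalize RatFunc.C p = P at *
  have hz : ∀ k : ℤ, P ^ k ≠ 0 := fun k => zpow_ne_zero k hP
  -- `TriId` factors the denominator of the equation as `l A C'' / (A' C')`. Applied to the rotated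
  -- triangle it also factors the numerator, and `l` cancels in the quotient.
  have hD : ∀ A B C A' B' C' C'' : RatFunc K, ∀ a b c : ℤ, A ≠ 0 → B ≠ 0 → C ≠ 0 → A' ≠ 0 →
      B' ≠ 0 → C' ≠ 0 →
      l * (A * B * C'') = A' * B * C' + P ^ (-2 * (1 + c - a)) * x * (A' * B' * C) +
        P ^ (-2 * (2 + c - b)) * x ^ 2 * (A * B' * C') →
      1 + P ^ (2 * a - b - c - 1) * (x * P ^ (b - c - 1) * (B' * C / (B * C'))) +
        P ^ (2 * a - b - c - 1) * P ^ (2 * b - c - a - 1) *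
          (x * P ^ (b - c - 1) * (B' * C / (B * C'))) *
          (x * P ^ (c - a - 1) * (C' * A / (C * A'))) = l * A * C'' / (A' * C') := by
    intro A B C A' B' C' C'' a b c hA hB hC hA' hB' hC' h
    have e₁ : P ^ (-2 * (1 + c - a)) = P ^ (2 * a - b - c - 1) * P ^ (b - c - 1) := by
      rw [← zpow_add₀ hP]; congr 1; ring
    have e₂ : P ^ (-2 * (2 + c - b)) = P ^ (2 * a - b - c - 1) * P ^ (2 * b - c - a - 1) *
        P ^ (b - c - 1) * P ^ (c - a - 1) := by
      rw [← zpow_add₀ hP, ← zpow_add₀ hP, ← zpow_add₀ hP]; congr 1; ring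
    rw [e₁, e₂] at h
    field_simp
    linear_combination -h
  rw [hD A B C A' B' C' C'' a b c hA hB hC hA' hB' hC' h₂]
  have h3 := hD C A B C' A' B' B'' c a b hC hA hB hC' hA' hB' h₁
  rw [h3]
  refine ⟨by positivity, ?_⟩
  have e : P ^ (b - c - 1 - 2) = P ^ (2 * a - b - c - 1) * P ^ (2 * b - c - a - 1) *
      P ^ (c - a - 1) := by
    rw [← zpow_add₀ hP, ← zpow_add₀ hP]; congr 1; ring
  rw [e]
  field_simp

theorem isRationalSolution_triPoint (hp : p ≠ 0) {A B C : K[X]} {a b c : ℤ} (hA : A.coeff 0 = 1)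
    (hB : B.coeff 0 = 1) (hC : C.coeff 0 = 1) (h₂ : TriId (timeUnit hp) A B C a b c)
    (h₀ : TriId (timeUnit hp) B C A b c a) (h₁ : TriId (timeUnit hp) C A B c a b) :
    IsRationalSolution p
      ![p ^ (2 * a - b - c - 1), p ^ (2 * b - c - a - 1), p ^ (2 * c - a - b - 1)]
      (triPoint p A B C a b c).f := by
  refine ⟨?_, ?_, ?_⟩
  · change p ^ (2 * a - b - c - 1) * p ^ (2 * b - c - a - 1) * p ^ (2 * c - a - b - 1) = _
    rw [← zpow_add₀ hp, ← zpow_add₀ hp]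
    congr 1
    ring
  · have nz : ∀ {P : K[X]}, P.coeff 0 = 1 → algebraMap K[X] (RatFunc K) P ≠ 0 := fun h =>
      RatFunc.algebraMap_ne_zero (ne_zero_of_coeff_zero h)
    have nz' : ∀ {P : K[X]}, P.coeff 0 = 1 →
        algebraMap K[X] (RatFunc K) (sh (timeUnit hp) P) ≠ 0 := fun h =>
      nz (by simpa using h)
    have hA' := nz' hA
    have hB' := nz' hB
    have hC' := nz' hC
    replace hA := nz hA
    replace hB := nz hB
    replace hC := nz hC
    have hP : RatFunc.C p ≠ 0 := by simpa using hp
    change RatFunc.X * RatFunc.C (p ^ (b - c - 1)) * shiftRatio p B C *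
      (RatFunc.X * RatFunc.C (p ^ (c - a - 1)) * shiftRatio p C A) *
      (RatFunc.X * RatFunc.C (p ^ (a - b - 1)) * shiftRatio p A B) = _
    simp only [shiftRatio, polyShift_eq_sh hp, map_zpow₀]
    rw [show (-3 : ℤ) = (b - c - 1) + (c - a - 1) + (a - b - 1) by ring, zpow_add₀ hP,
      zpow_add₀ hP]
    field_simp
  · intro i
    fin_cases i
    · exact timeShift_triPoint hp hA hB hC h₂ h₁
    · exact timeShift_triPoint hp hB hC hA h₀ h₂
    · exact timeShift_triPoint hp hC hA hB h₁ h₀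

end RationalSolution

/-! ### The lattice of triangles -/

section Lattice

variable {R : Type*} [CommRing R] [IsDomain R] {t : Rˣ} (ht : ∀ k : ℤ, t ^ k = 1 → k = 0)

/-- The degree of `Q_{m,n}`. -/
def okDeg (m n : ℤ) : ℤ := m ^ 2 - m * n + n ^ 2 - m

/-- The triangle with the vertices `(m, n)`, `(m + 1, n)`, `(m + 1, n + 1)`. -/
def okTri (m n : ℤ) : Tri t :=
  (wordPerm ht T₁ ^ m) ((wordPerm ht T₂ ^ n) (Tri.base t))

/-- The `q`-Okamoto polynomials over the ring `R`. -/
def okPoly (m n : ℤ) : R[X] := (okTri ht m n).A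

theorem okTri_succ_left (m n : ℤ) :
    okTri ht (m + 1) n = wordPerm ht T₁ (okTri ht m n) := by
  rw [okTri, add_comm, zpow_add, zpow_one]
  rfl

/-- The innermost power of `T₂` has to be moved past `T₁ ^ m`; this is where commutation, and with
it the braid relation, enters. -/
theorem okTri_succ_right (m n : ℤ) :
    okTri ht m (n + 1) = wordPerm ht T₂ (okTri ht m n) := by
  rw [okTri, okTri, add_comm, zpow_add, zpow_one]
  have := ((commute_T ht).zpow_left m).eq
  exact congrArg (fun f => f ((wordPerm ht T₂ ^ n) (Tri.base t))) this

/-- `T₁` moves the vertex `B` to the first place. Similarly `T₂` moves `C` to the second place,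
which locates the third vertex in the next lemma. -/
theorem okTri_B (m n : ℤ) : (okTri ht m n).B = okPoly ht (m + 1) n := by
  rw [okPoly, okTri_succ_left]
  rfl

theorem okTri_C (m n : ℤ) : (okTri ht m n).C = okPoly ht (m + 1) (n + 1) := by
  rw [← okTri_B, okTri_succ_right]
  rfl

/-- The degrees of a triangle are those of the triangle at `(m, n)`. -/
def DegAt (v : Tri t) (m n : ℤ) : Prop :=
  v.a = okDeg m n ∧ v.b = okDeg (m + 1) n ∧ v.c = okDeg (m + 1) (n + 1)

/-- The equivalence, rather than one implication, serves the induction over `ℤ` in both directions.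
-/
theorem degAt_T₁ (v : Tri t) (m n : ℤ) : DegAt (wordPerm ht T₁ v) (m + 1) n ↔ DegAt v m n := by
  have h₁ : (wordPerm ht T₁ v).a = v.b := rfl
  have h₂ : (wordPerm ht T₁ v).b = v.b + v.c + 1 - v.a + v.b + 1 - v.c := rfl
  have h₃ : (wordPerm ht T₁ v).c = v.b + v.c + 1 - v.a := rfl
  rw [DegAt, DegAt, h₁, h₂, h₃]
  simp only [okDeg]
  constructor <;> rintro ⟨h, h', h''⟩ <;> refine ⟨?_, ?_, ?_⟩ <;> linarith

theorem degAt_T₂ (v : Tri t) (m n : ℤ) : DegAt (wordPerm ht T₂ v) m (n + 1) ↔ DegAt v m n := by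
  have h₁ : (wordPerm ht T₂ v).a = v.c + v.a + 1 - v.b := rfl
  have h₂ : (wordPerm ht T₂ v).b = v.c := rfl
  have h₃ : (wordPerm ht T₂ v).c = v.c + v.a + 1 - v.b + v.c + 1 - v.a := rfl
  rw [DegAt, DegAt, h₁, h₂, h₃]
  simp only [okDeg]
  constructor <;> rintro ⟨h, h', h''⟩ <;> refine ⟨?_, ?_, ?_⟩ <;> linarith

theorem degAt_okTri (m n : ℤ) : DegAt (okTri ht m n) m n := by
  induction m using Int.induction_on with
  | zero =>
    induction n using Int.induction_on with
    | zero => exact ⟨by simp [okTri, Tri.base, okDeg], by simp [okTri, Tri.base, okDeg],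
        by simp [okTri, Tri.base, okDeg]⟩
    | succ n ih => rwa [okTri_succ_right, degAt_T₂]
    | pred n ih =>
      rwa [← degAt_T₂ ht, ← okTri_succ_right, sub_add_cancel]
  | succ m ih => rwa [okTri_succ_left, degAt_T₁]
  | pred m ih => rwa [← degAt_T₁ ht, ← okTri_succ_left, sub_add_cancel]

theorem refl_okPoly₁ (m n : ℤ) :
    Refl t (okPoly ht m n) (okPoly ht (m + 2) (n + 1)) (okPoly ht (m + 1) n)
      (okPoly ht (m + 1) (n + 1)) (okDeg m n) (okDeg (m + 1) n) (okDeg (m + 1) (n + 1)) := by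
  obtain ⟨ha, hb, hc⟩ := degAt_okTri ht m n
  have h := (okTri ht m n).refl_reflect ht
  have e : ((okTri ht m n).reflect ht).A = okPoly ht (m + 2) (n + 1) := by
    rw [show m + 2 = m + 1 + 1 by ring, ← okTri_C, okTri_succ_left]
    rfl
  rwa [e, ha, hb, hc, okTri_B, okTri_C] at h

theorem refl_okPoly₂ (m n : ℤ) :
    Refl t (okPoly ht (m + 1) n) (okPoly ht m (n + 1)) (okPoly ht (m + 1) (n + 1))
      (okPoly ht m n) (okDeg (m + 1) n) (okDeg (m + 1) (n + 1)) (okDeg m n) := by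
  obtain ⟨ha, hb, hc⟩ := degAt_okTri ht m n
  have h := (rotPerm t (okTri ht m n)).refl_reflect ht
  have e : ((rotPerm t (okTri ht m n)).reflect ht).A = okPoly ht m (n + 1) := by
    rw [okPoly, okTri_succ_right]
    rfl
  rw [e] at h
  change Refl t (okTri ht m n).B _ (okTri ht m n).C (okTri ht m n).A (okTri ht m n).b
    (okTri ht m n).c (okTri ht m n).a at h
  rwa [ha, hb, hc, okTri_B, okTri_C] at h

/-- The reflection takes place in the triangle reached after the first letter of `T₂`, whose
vertices are `(m, n)`, `(m, n + 1)`, `(m + 1, n + 1)`. -/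
theorem refl_okPoly₃ (m n : ℤ) :
    Refl t (okPoly ht m n) (okPoly ht (m + 1) (n + 2)) (okPoly ht m (n + 1))
      (okPoly ht (m + 1) (n + 1)) (okDeg m n) (okDeg m (n + 1)) (okDeg (m + 1) (n + 1)) := by
  obtain ⟨ha, hb, hc⟩ := degAt_okTri ht m n
  obtain ⟨ha', -, -⟩ := degAt_okTri ht m (n + 1)
  have h := (genPerm ht (.s 1) (okTri ht m n)).refl_reflect ht
  have e : ((genPerm ht (.s 1) (okTri ht m n)).reflect ht).A = okPoly ht (m + 1) (n + 2) := by
    rw [show n + 2 = n + 1 + 1 by ring, ← okTri_C, okTri_succ_right]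
    rfl
  have eB : (genPerm ht (.s 1) (okTri ht m n)).B = okPoly ht m (n + 1) := by
    rw [okPoly, okTri_succ_right]
    rfl
  have eb : (genPerm ht (.s 1) (okTri ht m n)).b = okDeg m (n + 1) := by
    rw [← ha', okTri_succ_right]
    rfl
  rw [e, eB, eb] at h
  change Refl t (okTri ht m n).A _ _ (okTri ht m n).C (okTri ht m n).a _ (okTri ht m n).c at h
  rwa [ha, hc, okTri_C] at h

end Lattice

/-! ### Specialisation to the field `K` -/

section Specialization

variable {K : Type*} [Field K] {p : K} {R : Type*} [CommRing R] [IsDomain R] {t : Rˣ}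
  (ht : ∀ k : ℤ, t ^ k = 1 → k = 0)

/-- The first two recurrences are left reflection relations and the third is a right one; their
exponents come from differences of the quadratic form `okDeg`, multiplied by `-2` because `t` maps
to `p⁻²`. -/
theorem isQOkamoto_map (hp : p ≠ 0) {ψ : R →+* K}
    (hψ : Units.map ψ.toMonoidHom t = timeUnit hp) :
    IsQOkamoto p (fun m n => (okPoly ht m n).map ψ) where
  rec₁ m n := by
    have h := ((refl_okPoly₁ ht (m - 1) n).map ψ).left
    rw [hψ, mon_timeUnit, show m - 1 + 2 = m + 1 by ring, sub_add_cancel,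
      show -2 * (1 + okDeg m (n + 1) - okDeg (m - 1) n) = -2 * m - 2 * n by
        simp only [okDeg]; ring] at h
    simp only [polyShift_eq_sh hp]
    linear_combination h
  rec₂ m n := by
    have h := ((refl_okPoly₂ ht m n).map ψ).left
    rw [hψ, mon_timeUnit, show -2 * (1 + okDeg m n - okDeg (m + 1) n) = 4 * m - 2 * n - 2 by
        simp only [okDeg]; ring] at h
    simp only [polyShift_eq_sh hp]
    linear_combination h
  rec₃ m n := by
    have h := ((refl_okPoly₃ ht m (n - 1)).map ψ).right
    rw [hψ, mon_timeUnit, show n - 1 + 2 = n + 1 by ring, sub_add_cancel,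
      show -2 * (okDeg m (n - 1) - okDeg m n) = 4 * n - 2 * m - 2 by
        simp only [okDeg]; ring] at h
    simp only [polyShift_eq_sh hp]
    linear_combination h
  init₀₀ := by simp [okPoly, okTri, Tri.base]
  init₁₀ := by
    rw [show (1 : ℤ) = 0 + 1 from rfl, ← okTri_B]
    simp [okTri, Tri.base]
  init₁₁ := by
    rw [show (1 : ℤ) = 0 + 1 from rfl, ← okTri_C]
    simp [okTri, Tri.base]

theorem coeff_zero_map_okPoly (ψ : R →+* K) (m n : ℤ) :
    ((okPoly ht m n).map ψ).coeff 0 = 1 := by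
  rw [coeff_map, okPoly, (okTri ht m n).good.vA.coeff, map_one]

/-- The values at the triangle `(m, n)` are those given by the `q`-Okamoto polynomials. -/
theorem point_okTri (ψ : R →+* K) (m n : ℤ) :
    (okTri ht m n).point p ψ =
      { a := fun i => RatFunc.C (okamotoParam p m n i)
        f := okamotoSolution p (fun m n => (okPoly ht m n).map ψ) m n } := by
  obtain ⟨ha, hb, hc⟩ := degAt_okTri ht m n
  have e₁ : 2 * okDeg m n - okDeg (m + 1) n - okDeg (m + 1) (n + 1) - 1 = -3 * m - 1 := by
    simp only [okDeg]; ring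
  have e₂ : 2 * okDeg (m + 1) n - okDeg (m + 1) (n + 1) - okDeg m n - 1 =
      3 * m - 3 * n - 1 := by
    simp only [okDeg]; ring
  have e₃ : 2 * okDeg (m + 1) (n + 1) - okDeg m n - okDeg (m + 1) n - 1 = 3 * n - 1 := by
    simp only [okDeg]; ring
  have e₄ : okDeg (m + 1) n - okDeg (m + 1) (n + 1) - 1 = m - 2 * n - 1 := by
    simp only [okDeg]; ring
  have e₅ : okDeg (m + 1) (n + 1) - okDeg m n - 1 = m + n - 1 := by
    simp only [okDeg]; ring
  have e₆ : okDeg m n - okDeg (m + 1) n - 1 = n - 2 * m - 1 := by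
    simp only [okDeg]; ring
  rw [Tri.point, okTri_B, okTri_C, ha, hb, hc, triPoint, e₁, e₂, e₃, e₄, e₅, e₆]
  rfl

theorem isRationalSolution_okPoly (hp : p ≠ 0) {ψ : R →+* K}
    (hψ : Units.map ψ.toMonoidHom t = timeUnit hp) (m n : ℤ) :
    IsRationalSolution p (okamotoParam p m n)
      (okamotoSolution p (fun m n => (okPoly ht m n).map ψ) m n) := by
  have g := (okTri ht m n).good
  have hi₂ := g.iC.map ψ
  have hi₀ := g.iA.map ψ
  have hi₁ := g.iB.map ψ
  rw [hψ] at hi₀ hi₁ hi₂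
  have hs := isRationalSolution_triPoint hp (by simp [g.vA.coeff]) (by simp [g.vB.coeff])
    (by simp [g.vC.coeff]) hi₂ hi₀ hi₁
  have hpt := point_okTri ht (p := p) ψ m n
  have hf := congrArg Point.f hpt
  have ha := congrArg Point.a hpt
  simp only [Tri.point] at hf ha
  rw [hf] at hs
  convert hs using 1
  funext i
  exact RatFunc.C_injective (congrFun ha i).symm

end Specialization

/-! ### Uniqueness of the family -/

section Uniqueness

variable {K : Type*} [Field K] {p : K}

/-- The recurrence relations determine a family without zeros. -/
theorem IsQOkamoto.unique (hp : p ≠ 0) {Q Q' : ℤ → ℤ → K[X]} (hQ : IsQOkamoto p Q)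
    (h0 : ∀ m n, Q m n ≠ 0) (hQ' : IsQOkamoto p Q') : Q' = Q := by
  have hinj : Function.Injective (polyShift p) := by
    have : polyShift p = sh (timeUnit hp) := funext (polyShift_eq_sh hp)
    rw [this]
    exact sh_injective _
  have hs : ∀ m n, polyShift p (Q m n) ≠ 0 := fun m n h => by
    have : polyShift p (0 : K[X]) = 0 := by simp [polyShift]
    exact h0 m n (hinj (h.trans this.symm))
  -- Each recurrence concerns a rhombus of the lattice: the product on the left belongs to two
  -- opposite vertices, and the right side only to the other two. So either opposite vertex is
  -- determined by the remaining three, since the factors of `Q` are nonzero.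
  have l₁ : ∀ m n, Q' (m - 1) n = Q (m - 1) n → Q' m n = Q m n →
      Q' m (n + 1) = Q m (n + 1) → Q' (m + 1) (n + 1) = Q (m + 1) (n + 1) := by
    intro m n h₁ h₂ h₃
    have e := hQ'.rec₁ m n
    rw [h₁, h₂, h₃, ← hQ.rec₁] at e
    exact hinj (mul_left_cancel₀ (h0 _ _) e)
  have r₁ : ∀ m n, Q' (m + 1) (n + 1) = Q (m + 1) (n + 1) → Q' m n = Q m n →
      Q' m (n + 1) = Q m (n + 1) → Q' (m - 1) n = Q (m - 1) n := by
    intro m n h₁ h₂ h₃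
    have e := hQ'.rec₁ m n
    rw [h₁, h₂, h₃, ← hQ.rec₁] at e
    exact mul_right_cancel₀ (hs _ _) e
  have l₂ : ∀ m n, Q' (m + 1) n = Q (m + 1) n → Q' m n = Q m n →
      Q' (m + 1) (n + 1) = Q (m + 1) (n + 1) → Q' m (n + 1) = Q m (n + 1) := by
    intro m n h₁ h₂ h₃
    have e := hQ'.rec₂ m n
    rw [h₁, h₂, h₃, ← hQ.rec₂] at e
    exact hinj (mul_left_cancel₀ (h0 _ _) e)
  have r₂ : ∀ m n, Q' m (n + 1) = Q m (n + 1) → Q' m n = Q m n →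
      Q' (m + 1) (n + 1) = Q (m + 1) (n + 1) → Q' (m + 1) n = Q (m + 1) n := by
    intro m n h₁ h₂ h₃
    have e := hQ'.rec₂ m n
    rw [h₁, h₂, h₃, ← hQ.rec₂] at e
    exact mul_right_cancel₀ (hs _ _) e
  have l₃ : ∀ m n, Q' (m + 1) (n + 1) = Q (m + 1) (n + 1) → Q' m n = Q m n →
      Q' (m + 1) n = Q (m + 1) n → Q' m (n - 1) = Q m (n - 1) := by
    intro m n h₁ h₂ h₃
    have e := hQ'.rec₃ m n
    rw [h₁, h₂, h₃, ← hQ.rec₃] at e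
    exact hinj (mul_left_cancel₀ (h0 _ _) e)
  have r₃ : ∀ m n, Q' m (n - 1) = Q m (n - 1) → Q' m n = Q m n →
      Q' (m + 1) n = Q (m + 1) n → Q' (m + 1) (n + 1) = Q (m + 1) (n + 1) := by
    intro m n h₁ h₂ h₃
    have e := hQ'.rec₃ m n
    rw [h₁, h₂, h₃, ← hQ.rec₃] at e
    exact mul_right_cancel₀ (hs _ _) e
  -- Agreement on a whole triangle is the inductive statement: its three values suffice to pass to
  -- each neighbouring triangle.
  have key : ∀ m n : ℤ, Q' m n = Q m n ∧ Q' (m + 1) n = Q (m + 1) n ∧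
      Q' (m + 1) (n + 1) = Q (m + 1) (n + 1) := by
    intro m n
    induction m using Int.induction_on with
    | zero =>
      induction n using Int.induction_on with
      | zero =>
        refine ⟨?_, ?_, ?_⟩
        · rw [hQ.init₀₀, hQ'.init₀₀]
        · rw [zero_add, hQ.init₁₀, hQ'.init₁₀]
        · rw [zero_add, hQ.init₁₁, hQ'.init₁₁]
      | succ n ih =>
        obtain ⟨hA, hB, hC⟩ := ih
        have hD := l₂ _ _ hB hA hC
        exact ⟨hD, hC, r₃ _ _ (by rwa [add_sub_cancel_right]) hD hC⟩
      | pred n ih =>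
        obtain ⟨hA, hB, hC⟩ := ih
        have hD := l₃ _ _ hC hA hB
        exact ⟨hD, r₂ _ _ (by rwa [sub_add_cancel]) hD (by rwa [sub_add_cancel]),
          by rwa [sub_add_cancel]⟩
    | succ m ih =>
      obtain ⟨hA, hB, hC⟩ := ih
      have hD := l₁ _ _ (by rwa [add_sub_cancel_right]) hB hC
      exact ⟨hB, r₂ _ _ hC hB hD, hD⟩
    | pred m ih =>
      obtain ⟨hA, hB, hC⟩ := ih
      have hD := l₂ _ _ hB hA hC
      exact ⟨r₁ _ _ hC hA hD, by rwa [sub_add_cancel], by rwa [sub_add_cancel]⟩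
  funext m n
  exact (key m n).1

end Uniqueness

/-! ### The generic parameter -/

section Generic

open LaurentPolynomial in
/-- The time shift factor over the ring `ℤ[p, p⁻¹]`. -/
def genericUnit : (LaurentPolynomial ℤ)ˣ where
  val := T (-2)
  inv := T 2
  val_inv := by rw [← T_add]; simp
  inv_val := by rw [← T_add]; simp

theorem map_genericUnit {K : Type*} [Field K] (u : Kˣ) :
    Units.map (LaurentPolynomial.eval₂ (Int.castRingHom K) u).toMonoidHom genericUnit =
      u ^ (-2 : ℤ) :=
  Units.ext (LaurentPolynomial.eval₂_T (Int.castRingHom K) u (-2))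

/-- It suffices to test at `p = 2` in `ℚ`, where `2 ^ (-2k) = 1` forces `k = 0`. -/
theorem genericUnit_zpow (k : ℤ) (h : genericUnit ^ k = 1) : k = 0 := by
  have h2 := congrArg (Units.map
    (LaurentPolynomial.eval₂ (Int.castRingHom ℚ) (Units.mk0 2 two_ne_zero)).toMonoidHom) h
  rw [map_zpow, map_genericUnit, map_one, ← zpow_mul, Units.ext_iff] at h2
  simp only [Units.val_zpow_eq_zpow_val, Units.val_mk0, Units.val_one] at h2
  have := zpow_right_injective₀ (a := (2 : ℚ)) (by norm_num) (by norm_num)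
    (h2.trans (zpow_zero (2 : ℚ)).symm)
  omega

end Generic

end QP4

end

theorem mainTheorem6 {K : Type*} [Field K] (p : K) (hp : p ≠ 0) :
    ∃ Q : ℤ → ℤ → Polynomial K,
      QP4.IsQOkamoto p Q ∧
      (∀ Q' : ℤ → ℤ → Polynomial K, QP4.IsQOkamoto p Q' → Q' = Q) ∧
      (∀ m n : ℤ, (Q m n).Monic) ∧
      ∀ m n : ℤ,
        QP4.Sends (QP4.wordZPow QP4.T₁ m ++ QP4.wordZPow QP4.T₂ n) (QP4.seed p)
          { a := fun i => RatFunc.C (QP4.okamotoParam p m n i)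
            f := QP4.okamotoSolution p Q m n } ∧
        QP4.IsRationalSolution p (QP4.okamotoParam p m n) (QP4.okamotoSolution p Q m n) := by
  have ht := QP4.genericUnit_zpow
  have hψ : _ = QP4.timeUnit hp := QP4.map_genericUnit (Units.mk0 p hp)
  set ψ := LaurentPolynomial.eval₂ (Int.castRingHom K) (Units.mk0 p hp)
  have hQ := QP4.isQOkamoto_map ht hp hψ
  refine ⟨fun m n => (QP4.okPoly ht m n).map ψ, hQ, fun Q' hQ' => hQ.unique hp (fun m n =>
    QP4.ne_zero_of_coeff_zero (QP4.coeff_zero_map_okPoly ht ψ m n)) hQ', fun m n =>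
    (QP4.okTri ht m n).good.vA.monic.map ψ, fun m n =>
    ⟨?_, QP4.isRationalSolution_okPoly ht hp hψ m n⟩⟩
  have h := QP4.Tri.sends ht hp hψ (QP4.wordZPow QP4.T₁ m ++ QP4.wordZPow QP4.T₂ n)
    (QP4.Tri.base QP4.genericUnit)
  -- Letters act from left to right, so the word for `T₁ ^ m T₂ ^ n` applies `T₁ ^ m` first, whereas
  -- `okTri` applies `T₂ ^ n` first; commutation reconciles the two.
  rw [QP4.Tri.point_base, QP4.wordPerm_append, QP4.wordPerm_wordZPow, QP4.wordPerm_wordZPow,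
    ← (((QP4.commute_T ht).zpow_left m).zpow_right n).eq] at h
  rw [← QP4.point_okTri ht]
  exact h
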